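/- All codes are binary and linear. Let $C=C^\perp\subseteq\mathbb{F}_2^n$ be a self-dual code (with respect to the standard inner product). It is singly even if it has a codeword of weight $\equiv 2\pmod 4$. The minimum weight $d(D)$ of a set $D\subseteq\mathbb{F}_2^n$ is the least non-zero weight of a vector in $D$; an $[n,m,d]$ code is a code of length $n$, dimension $m$ and minimum weight $d$. A self-dual code $C$ of length $n$ is extremal if $d(C)=4\lfloor n/24\rfloor+4$ when $n\not\equiv 22\pmod{24}$, and $d(C)=4\lfloor n/24\rfloor+6$ when $n\equiv 22\pmod{24}$. For a singly even self-dual code $C$, let $C_0$ be the subcode of codewords of weight $\equiv 0\pmod 4$, and let $S=C_0^\perp\setminus C$ be the shadow of $C$. The code $C$ is $s$-extremal if $d(S)=n/2+4-2d(C)$, or, in the case that $n\equiv 22\pmod{24}$ and $d(C)=4\lfloor n/24\rfloor+6$, if $d(S)=n/2+8-2d(C)$. Two self-dual codes $C,C'$ of length $n$ are neighbors if $\dim(C\cap C')=n/2-1$. Let $k\ge 0$ be an integer and let $C$ be a code as in (i), (ii) or (iii) below. Then there are cosets $C_1,C_2,C_3$ of $C_0$ such that $C_0^\perp=C_0\cup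 C_1\cup C_2\cup C_3$, $C=C_0\cup C_2$ and $S=C_1\cup C_3$; and for every choice of such cosets, the sets $N_1(C)=C_0\cup C_1$ and $N_3(C)=C_0\cup C_3$ are self-dual codes that are neighbors of $C$, and the following hold. (i) If $C$ is an $s$-extremal singly even self-dual $[24k+4,12k+2,4k+2]$ code, then $N_1(C)$ and $N_3(C)$ are also $s$-extremal singly even self-dual $[24k+4,12k+2,4k+2]$ codes. (ii) If $C$ is an $s$-extremal and extremal singly even self-dual $[24k+20,12k+10,4k+4]$ code, then $N_1(C)$ and $N_3(C)$ are also $s$-extremal and extremal singly even self-dual $[24k+20,12k+10,4k+4]$ codes. (iii) If $C$ is an $s$-extremal singly even self-dual $[24k+12,12k+6,4k+2]$ code, then $N_1(C)$ and $N_3(C)$ are $s$-extremal and extremal singly even self-dual $[24k+12,12k+6,4k+4]$ codes. -/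

import Mathlib

/-- The set of vectors of length `n` over the binary field. -/
abbrev BinaryVector (n : ℕ) : Type := Fin n → ZMod 2

/-- A binary (linear) code of length `n`. -/
abbrev BinaryCode (n : ℕ) : Type := Submodule (ZMod 2) (BinaryVector n)

namespace BinaryCode

/-- The dual `D^⊥` of a set `D` of vectors, with respect to the standard inner product. -/
def dual {n : ℕ} (D : Set (BinaryVector n)) : BinaryCode n where
  carrier := {x | ∀ y ∈ D, x ⬝ᵥ y = 0}
  add_mem' := by
    intro a b ha hb y hy
    rw [add_dotProduct, ha y hy, hb y hy, add_zero]
  zero_mem' := by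
    intro y _
    exact zero_dotProduct y
  smul_mem' := by
    intro c x hx y hy
    rw [smul_dotProduct, hx y hy, smul_zero]

/-- `C` is self-dual: `C = C^⊥`. -/
def IsSelfDual {n : ℕ} (C : BinaryCode n) : Prop :=
  C = dual (C : Set (BinaryVector n))

/-- `C` is a singly even self-dual code: self-dual, with at least one codeword of
weight `≡ 2 (mod 4)`. -/
def IsSinglyEvenSelfDual {n : ℕ} (C : BinaryCode n) : Prop :=
  IsSelfDual C ∧ ∃ x ∈ C, hammingNorm x % 4 = 2

/-- `d` is the minimum weight `d(D)` of `D`, the least non-zero weight of a vector in `D`. -/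
def HasMinWeight {n : ℕ} (D : Set (BinaryVector n)) (d : ℕ) : Prop :=
  IsLeast {w : ℕ | w ≠ 0 ∧ ∃ x ∈ D, hammingNorm x = w} d

/-- `C` is an `[n, m, d]` code, `n` being its length. -/
def HasParameters {n : ℕ} (C : BinaryCode n) (m d : ℕ) : Prop :=
  Module.finrank (ZMod 2) C = m ∧ HasMinWeight (C : Set (BinaryVector n)) d

/-- The self-dual code `C` is extremal: its minimum weight is `4⌊n/24⌋ + 6` if
`n ≡ 22 (mod 24)`, and `4⌊n/24⌋ + 4` otherwise. -/
def IsExtremal {n : ℕ} (C : BinaryCode n) : Prop :=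
  IsSelfDual C ∧
    HasMinWeight (C : Set (BinaryVector n))
      (if n % 24 = 22 then 4 * (n / 24) + 6 else 4 * (n / 24) + 4)

/-- `C₀`, the set of codewords of `C` of weight `≡ 0 (mod 4)`. -/
def doublyEvenPart {n : ℕ} (C : BinaryCode n) : Set (BinaryVector n) :=
  {x | x ∈ C ∧ hammingNorm x % 4 = 0}

/-- The shadow `S = C₀^⊥ \ C`. -/
def shadow {n : ℕ} (C : BinaryCode n) : Set (BinaryVector n) :=
  (dual (doublyEvenPart C) : Set (BinaryVector n)) \ (C : Set (BinaryVector n))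

/-- `C` is an `s`-extremal singly even self-dual code: `d(S) = n/2 + 4 - 2 d(C)`, except that
`d(S) = n/2 + 8 - 2 d(C)` if `n ≡ 22 (mod 24)` and `d(C) = 4⌊n/24⌋ + 6`. (The length `n` of a
self-dual code is even.) -/
def IsSExtremal {n : ℕ} (C : BinaryCode n) : Prop :=
  IsSinglyEvenSelfDual C ∧
    ∃ d s : ℕ, HasMinWeight (C : Set (BinaryVector n)) d ∧ HasMinWeight (shadow C) s ∧
      s + 2 * d = if n % 24 = 22 ∧ d = 4 * (n / 24) + 6 then n / 2 + 8 else n / 2 + 4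

/-- `D` is a coset `v + C₀` of `C₀`. -/
def IsDoublyEvenCoset {n : ℕ} (C : BinaryCode n) (D : Set (BinaryVector n)) : Prop :=
  ∃ v : BinaryVector n, D = (fun c => v + c) '' doublyEvenPart C

/-- `C₁, C₂, C₃` are cosets of `C₀` with `C₀^⊥ = C₀ ∪ C₁ ∪ C₂ ∪ C₃`, where
`C = C₀ ∪ C₂` and `S = C₁ ∪ C₃`. -/
structure IsCosetDecomposition {n : ℕ} (C : BinaryCode n)
    (C₁ C₂ C₃ : Set (BinaryVector n)) : Prop where
  coset_one : IsDoublyEvenCoset C C₁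
  coset_two : IsDoublyEvenCoset C C₂
  coset_three : IsDoublyEvenCoset C C₃
  dual_eq : (dual (doublyEvenPart C) : Set (BinaryVector n)) =
    doublyEvenPart C ∪ C₁ ∪ C₂ ∪ C₃
  code_eq : (C : Set (BinaryVector n)) = doublyEvenPart C ∪ C₂
  shadow_eq : shadow C = C₁ ∪ C₃

/-- Self-dual codes `C`, `C'` of length `n` are neighbors if `dim (C ∩ C') = n/2 - 1`. -/
def IsNeighbor {n : ℕ} (C C' : BinaryCode n) : Prop :=
  IsSelfDual C ∧ IsSelfDual C' ∧
    Module.finrank (ZMod 2) (C ⊓ C' : BinaryCode n) + 1 = n / 2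

/-- The sets `N₁(C) = C₀ ∪ C₁` and `N₃(C) = C₀ ∪ C₃` are linear codes, are neighbors of `C`,
and have the property `P`. The cosets `C₁, C₂, C₃` exist, and the assertion holds for every
choice of their labels. -/
def ShadowNeighborsSatisfy {n : ℕ} (C : BinaryCode n) (P : BinaryCode n → Prop) : Prop :=
  (∃ C₁ C₂ C₃ : Set (BinaryVector n), IsCosetDecomposition C C₁ C₂ C₃) ∧
    ∀ C₁ C₂ C₃ : Set (BinaryVector n), IsCosetDecomposition C C₁ C₂ C₃ →
      ∃ N₁ N₃ : BinaryCode n,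
        (N₁ : Set (BinaryVector n)) = doublyEvenPart C ∪ C₁ ∧
        (N₃ : Set (BinaryVector n)) = doublyEvenPart C ∪ C₃ ∧
        IsNeighbor C N₁ ∧ IsNeighbor C N₃ ∧ P N₁ ∧ P N₃

end BinaryCode

/-! In all three cases the dimension `m = n/2` is congruent to 2 modulo 4, and every shadow vector
has weight congruent to `m` modulo 4 (`IsHalfWeightVector.hammingNorm_mod_four`). So adjoining a
shadow vector `v` to `C₀` gives a singly even self-dual code `N` whose doubly even part is again
`C₀` and whose shadow is `C₂` together with the shadow coset not adjoined: passing from `C` to `N`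
only permutes the three nontrivial cosets of `C₀`. Every minimum weight can therefore be read off
from the weights in `C₀`, `C₂` and the two halves of the shadow. Lower bounds are immediate; the
issue is whether they are attained.

In (i) and (ii) the minimum weight `s` of the shadow must occur in both halves. The difference of
the weight enumerators of the two halves is, up to scalars, invariant under the octahedral group,
because it is an eigenvector of the MacWilliams transform and only weights 2 modulo 4 occur. It
vanishes to order `s` at 0, hence at all six vertices 0, ∞, ±1, ±i. As `6 * s > n`, it is zero
(`weightForm_eq_zero`).

In (iii) a vector of weight `4k+4` must exist in `C₀`. Otherwise `N` has minimum weight at least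
`4k+6`, while its shadow has minimum weight `4k+2`. The shadow bound forces a factor `(1+y²)^(4k+2)`
in the weight enumerator of `N`, and the cofactor is a polynomial in the Gleason invariants
`(1+y²)^4` and `y²(1-y²)²`. It has too few coefficients: Lagrange inversion exhibits a nonzero
coefficient that would have to vanish (`octahedral_expansion_ne`). -/

namespace BinaryCode

variable {n : ℕ}

/-! ### Weights and dot products of binary vectors -/

theorem zmod_two_eq_zero_or_eq_one : ∀ a : ZMod 2, a = 0 ∨ a = 1 := by decide

theorem hammingNorm_eq_sum (x : BinaryVector n) :
    hammingNorm x = ∑ i, if x i ≠ 0 then 1 else 0 := by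
  simp [hammingNorm, Finset.card_filter]

theorem hammingNorm_add_add (x y : BinaryVector n) :
    hammingNorm (x + y) + 2 * hammingNorm (x * y) = hammingNorm x + hammingNorm y := by
  simp only [hammingNorm_eq_sum, Finset.mul_sum, ← Finset.sum_add_distrib]
  refine Finset.sum_congr rfl fun i _ => ?_
  simp only [Pi.add_apply, Pi.mul_apply]
  rcases zmod_two_eq_zero_or_eq_one (x i) with h | h <;>
    rcases zmod_two_eq_zero_or_eq_one (y i) with h' | h' <;> simp [h, h', CharTwo.add_self_eq_zero]

theorem dotProduct_eq_natCast (x y : BinaryVector n) :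
    x ⬝ᵥ y = (hammingNorm (x * y) : ZMod 2) := by
  rw [hammingNorm_eq_sum, Nat.cast_sum, dotProduct]
  refine Finset.sum_congr rfl fun i _ => ?_
  simp only [Pi.mul_apply]
  rcases zmod_two_eq_zero_or_eq_one (x i) with h | h <;>
    rcases zmod_two_eq_zero_or_eq_one (y i) with h' | h' <;> simp [h, h']

theorem mul_self_vector (x : BinaryVector n) : x * x = x := by
  ext i
  simp only [Pi.mul_apply]
  generalize x i = a
  revert a
  decide

theorem dotProduct_self_eq (x : BinaryVector n) : x ⬝ᵥ x = (hammingNorm x : ZMod 2) := by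
  rw [dotProduct_eq_natCast, mul_self_vector]

theorem zmod_two_ne_zero {a : ZMod 2} : a ≠ 0 ↔ a = 1 := by
  revert a
  decide

theorem add_self_vector (x : BinaryVector n) : x + x = 0 :=
  funext fun i => CharTwo.add_self_eq_zero (x i)

theorem natCast_zmod_two_eq_zero {a : ℕ} : (a : ZMod 2) = 0 ↔ a % 2 = 0 := by
  rw [ZMod.natCast_eq_zero_iff]
  omega

theorem hammingNorm_add_mod_of_eq_zero {x y : BinaryVector n} (h : x ⬝ᵥ y = 0) :
    hammingNorm (x + y) % 4 = (hammingNorm x + hammingNorm y) % 4 := by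
  rw [dotProduct_eq_natCast, natCast_zmod_two_eq_zero] at h
  have := hammingNorm_add_add x y
  omega

theorem hammingNorm_add_mod_of_ne_zero {x y : BinaryVector n} (h : x ⬝ᵥ y ≠ 0) :
    hammingNorm (x + y) % 4 = (hammingNorm x + hammingNorm y + 2) % 4 := by
  rw [Ne, dotProduct_eq_natCast, natCast_zmod_two_eq_zero] at h
  have := hammingNorm_add_add x y
  omega

/-! ### Self-dual codes, their shadows and the cosets of the doubly even part -/

theorem IsSelfDual.mem_iff {C : BinaryCode n} (h : IsSelfDual C) {x : BinaryVector n} :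
    x ∈ C ↔ ∀ y ∈ C, x ⬝ᵥ y = 0 := by
  conv_lhs => rw [h]
  rfl

theorem IsSelfDual.dotProduct_eq_zero {C : BinaryCode n} (h : IsSelfDual C)
    {x y : BinaryVector n} (hx : x ∈ C) (hy : y ∈ C) : x ⬝ᵥ y = 0 := h.mem_iff.1 hx y hy

theorem IsSelfDual.hammingNorm_mod_two {C : BinaryCode n} (h : IsSelfDual C)
    {x : BinaryVector n} (hx : x ∈ C) : hammingNorm x % 2 = 0 := by
  have := h.dotProduct_eq_zero hx hx
  rwa [dotProduct_self_eq, natCast_zmod_two_eq_zero] at this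

/-- The doubly even part of a self-dual code, as a code. -/
def doublyEvenSubcode (C : BinaryCode n) (h : IsSelfDual C) : BinaryCode n where
  carrier := doublyEvenPart C
  add_mem' := by
    rintro a b ⟨ha, ha'⟩ ⟨hb, hb'⟩
    refine ⟨C.add_mem ha hb, ?_⟩
    rw [hammingNorm_add_mod_of_eq_zero (h.dotProduct_eq_zero ha hb)]
    omega
  zero_mem' := ⟨C.zero_mem, by simp⟩
  smul_mem' := by
    rintro c x ⟨hx, hx'⟩
    rcases eq_or_ne c 0 with rfl | hc
    · exact ⟨by simp, by simp⟩
    · rw [zmod_two_ne_zero] at hc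
      subst hc
      exact ⟨by simpa using hx, by simpa using hx'⟩

theorem mem_doublyEvenPart {C : BinaryCode n} {x : BinaryVector n} :
    x ∈ doublyEvenPart C ↔ x ∈ C ∧ hammingNorm x % 4 = 0 := Iff.rfl

theorem mem_image_add_iff {D : Set (BinaryVector n)} {v x : BinaryVector n} :
    x ∈ (fun c => v + c) '' D ↔ v + x ∈ D := by
  constructor
  · rintro ⟨c, hc, rfl⟩
    simpa [← add_assoc, add_self_vector] using hc
  · intro h
    exact ⟨v + x, h, by simp [← add_assoc, add_self_vector]⟩

/-- A vector pairing with the codewords of `C` as half their weight does. -/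
def IsHalfWeightVector (C : BinaryCode n) (v : BinaryVector n) : Prop :=
  ∀ c ∈ C, v ⬝ᵥ c = 0 ↔ hammingNorm c % 4 = 0

theorem exists_dotProduct_eq (C : BinaryCode n) (f : C →ₗ[ZMod 2] ZMod 2) :
    ∃ v : BinaryVector n, ∀ c : C, v ⬝ᵥ (c : BinaryVector n) = f c := by
  obtain ⟨g, hg⟩ := f.exists_extend
  refine ⟨fun i => g (Pi.single i 1), fun c => ?_⟩
  rw [← hg, LinearMap.comp_apply, Submodule.subtype_apply, LinearMap.pi_apply_eq_sum_univ g]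
  simp only [dotProduct, smul_eq_mul]
  refine Finset.sum_congr rfl fun i _ => ?_
  rw [mul_comm]
  congr 2
  ext j
  simp [Pi.single_apply, eq_comm]

/-- Orthogonality makes half the weight, modulo 2, additive on `C`, and every linear functional on a
subspace is a dot product with some vector. -/
theorem IsSelfDual.exists_isHalfWeightVector {C : BinaryCode n} (h : IsSelfDual C) :
    ∃ v, IsHalfWeightVector C v := by
  let f : C →+ ZMod 2 :=
    { toFun := fun c => ((hammingNorm (c : BinaryVector n) / 2 : ℕ) : ZMod 2)
      map_zero' := by simp
      map_add' := by
        rintro ⟨x, hx⟩ ⟨y, hy⟩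
        have h1 := hammingNorm_add_mod_of_eq_zero (h.dotProduct_eq_zero hx hy)
        have h2 := h.hammingNorm_mod_two hx
        have h3 := h.hammingNorm_mod_two hy
        rw [← Nat.cast_add, ZMod.natCast_eq_natCast_iff']
        simp only [Submodule.coe_add]
        omega }
  obtain ⟨v, hv⟩ := exists_dotProduct_eq C (f.toZModLinearMap 2)
  refine ⟨v, fun c hc => ?_⟩
  have h2 := h.hammingNorm_mod_two hc
  have := hv ⟨c, hc⟩
  simp only at this
  rw [this]
  change ((hammingNorm c / 2 : ℕ) : ZMod 2) = 0 ↔ _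
  rw [natCast_zmod_two_eq_zero]
  omega

/-- `C₀` has index 2 in `C`, so only one nonzero functional on `C` kills `C₀`, namely half the
weight modulo 2; the zero functional corresponds to `C^⊥ = C`. -/
theorem isHalfWeightVector_iff_mem_shadow {C : BinaryCode n} (h : IsSinglyEvenSelfDual C)
    {v : BinaryVector n} : IsHalfWeightVector C v ↔ v ∈ shadow C := by
  obtain ⟨h, t, ht, ht'⟩ := h
  constructor
  · intro hv
    refine ⟨fun c hc => (hv c hc.1).2 hc.2, fun hvC => ?_⟩
    have := (hv t ht).1 (h.dotProduct_eq_zero hvC ht)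
    omega
  · rintro ⟨hv, hvC⟩ c hc
    refine ⟨fun h0 => ?_, fun h0 => hv c ⟨hc, h0⟩⟩
    by_contra hne
    -- A codeword `c` outside `C₀` with `v ⬝ᵥ c = 0` would make `v` orthogonal to all of `C`: adding
    -- `c` moves every other codeword outside `C₀` into `C₀`.
    refine hvC (h.mem_iff.2 fun y hy => ?_)
    by_cases hy4 : hammingNorm y % 4 = 0
    · exact hv y ⟨hy, hy4⟩
    · have h1 := h.hammingNorm_mod_two hy
      have h2 := h.hammingNorm_mod_two hc
      have h3 := hv (y + c) ⟨C.add_mem hy hc, by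
        rw [hammingNorm_add_mod_of_eq_zero (h.dotProduct_eq_zero hy hc)]
        omega⟩
      rwa [dotProduct_add, h0, add_zero] at h3

theorem IsHalfWeightVector.add_mem {C : BinaryCode n} (h : IsSelfDual C)
    {v w : BinaryVector n} (hv : IsHalfWeightVector C v) (hw : IsHalfWeightVector C w) :
    v + w ∈ C := by
  refine h.mem_iff.2 fun y hy => ?_
  rw [add_dotProduct]
  by_cases hy4 : hammingNorm y % 4 = 0
  · rw [(hv y hy).2 hy4, (hw y hy).2 hy4, add_zero]
  · have h1 := zmod_two_ne_zero.1 (mt (hv y hy).1 hy4)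
    have h2 := zmod_two_ne_zero.1 (mt (hw y hy).1 hy4)
    rw [h1, h2]
    decide

theorem IsHalfWeightVector.add {C : BinaryCode n} (h : IsSelfDual C)
    {v c : BinaryVector n} (hv : IsHalfWeightVector C v) (hc : c ∈ C) :
    IsHalfWeightVector C (v + c) := by
  intro y hy
  rw [add_dotProduct, h.dotProduct_eq_zero hc hy, add_zero, hv y hy]

/-- The weights in the shadow are all congruent modulo `4`. -/
theorem IsHalfWeightVector.hammingNorm_add_mod {C : BinaryCode n} (h : IsSelfDual C)
    {v c : BinaryVector n} (hv : IsHalfWeightVector C v) (hc : c ∈ C) :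
    hammingNorm (v + c) % 4 = hammingNorm v % 4 := by
  have h2 := h.hammingNorm_mod_two hc
  by_cases hc4 : hammingNorm c % 4 = 0
  · rw [hammingNorm_add_mod_of_eq_zero ((hv c hc).2 hc4)]
    omega
  · rw [hammingNorm_add_mod_of_ne_zero (mt (hv c hc).1 hc4)]
    omega

theorem mem_shadow_iff {C : BinaryCode n} (h : IsSinglyEvenSelfDual C) {v u : BinaryVector n}
    (hv : v ∈ shadow C) : u ∈ shadow C ↔ v + u ∈ C := by
  rw [← isHalfWeightVector_iff_mem_shadow h] at hv ⊢
  refine ⟨fun hu => hv.add_mem h.1 hu, fun hu => ?_⟩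
  have := hv.add h.1 hu
  rwa [← add_assoc, add_self_vector, zero_add] at this

theorem mem_dual_doublyEvenPart_iff {C : BinaryCode n} (h : IsSelfDual C) {u : BinaryVector n} :
    u ∈ dual (doublyEvenPart C) ↔ u ∈ C ∨ u ∈ shadow C := by
  constructor
  · intro hu
    by_cases huC : u ∈ C
    · exact Or.inl huC
    · exact Or.inr ⟨hu, huC⟩
  · rintro (hu | hu)
    · exact fun y hy => h.dotProduct_eq_zero hu hy.1
    · exact hu.1

theorem mem_doublyEvenPart_add_iff {C : BinaryCode n} (h : IsSelfDual C) {t c : BinaryVector n}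
    (ht : t ∈ C) (ht' : hammingNorm t % 4 = 2) (hc : c ∈ C) :
    t + c ∈ doublyEvenPart C ↔ c ∉ doublyEvenPart C := by
  have h2 := h.hammingNorm_mod_two hc
  simp only [mem_doublyEvenPart, C.add_mem ht hc, hc, true_and,
    hammingNorm_add_mod_of_eq_zero (h.dotProduct_eq_zero ht hc)]
  omega

theorem IsSinglyEvenSelfDual.exists_isCosetDecomposition {C : BinaryCode n}
    (h : IsSinglyEvenSelfDual C) : ∃ C₁ C₂ C₃, IsCosetDecomposition C C₁ C₂ C₃ := by
  obtain ⟨v, hv⟩ := h.1.exists_isHalfWeightVector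
  rw [isHalfWeightVector_iff_mem_shadow h] at hv
  obtain ⟨t, ht, ht'⟩ := h.2
  have key : ∀ c ∈ C, c ∈ doublyEvenPart C ∨ t + c ∈ doublyEvenPart C := fun c hc => by
    rw [mem_doublyEvenPart_add_iff h.1 ht ht' hc]
    exact em _
  have hsub : ∀ c, t + c ∈ C → c ∈ C := fun c hc => (Submodule.add_mem_iff_right C ht).1 hc
  have hcode : ∀ c, c ∈ C ↔ c ∈ doublyEvenPart C ∨ t + c ∈ doublyEvenPart C := fun c =>
    ⟨key c, fun hc => hc.elim (fun hc => hc.1) fun hc => hsub c hc.1⟩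
  have hsh : ∀ u, u ∈ shadow C ↔ v + u ∈ doublyEvenPart C ∨ v + t + u ∈ doublyEvenPart C :=
    fun u => by
      rw [mem_shadow_iff h hv, hcode, add_comm v t, add_assoc]
  -- With `t` of weight 2 modulo 4 in `C` and `v` in the shadow, the three nontrivial cosets are
  -- represented by `v`, `t` and `v + t`.
  refine ⟨_, _, _, ⟨v, rfl⟩, ⟨t, rfl⟩, ⟨v + t, rfl⟩, ?_, ?_, ?_⟩
  · ext u
    simp only [SetLike.mem_coe, mem_dual_doublyEvenPart_iff h.1, Set.mem_union, mem_image_add_iff,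
      hcode, hsh]
    tauto
  · ext u
    simp only [SetLike.mem_coe, Set.mem_union, mem_image_add_iff, hcode]
  · ext u
    simp only [Set.mem_union, mem_image_add_iff, hsh]

theorem IsCosetDecomposition.swap {C : BinaryCode n} {C₁ C₂ C₃ : Set (BinaryVector n)}
    (h : IsCosetDecomposition C C₁ C₂ C₃) : IsCosetDecomposition C C₃ C₂ C₁ where
  coset_one := h.coset_three
  coset_two := h.coset_two
  coset_three := h.coset_one
  dual_eq := by rw [h.dual_eq]; ext; simp only [Set.mem_union]; tauto
  code_eq := h.code_eq
  shadow_eq := by rw [h.shadow_eq, Set.union_comm]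

theorem IsCosetDecomposition.exists_eq {C : BinaryCode n}
    {C₁ C₂ C₃ : Set (BinaryVector n)} (h : IsCosetDecomposition C C₁ C₂ C₃) :
    ∃ v ∈ shadow C, C₁ = (fun c => v + c) '' doublyEvenPart C := by
  obtain ⟨v, hv⟩ := h.coset_one
  refine ⟨v, ?_, hv⟩
  rw [h.shadow_eq, hv]
  refine Or.inl (mem_image_add_iff.2 ?_)
  rw [add_self_vector]
  exact ⟨C.zero_mem, by simp⟩

/-! ### Neighbors generated by the doubly even part and a shadow vector -/

theorem natCard_eq_two_pow (D : BinaryCode n) :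
    (D : Set (BinaryVector n)).ncard = 2 ^ Module.finrank (ZMod 2) D := by
  have := Module.natCard_eq_pow_finrank (K := ZMod 2) (V := D)
  rw [Nat.card_zmod] at this
  rw [← this]
  rfl

theorem finrank_eq_add_one {D E : BinaryCode n} {v : BinaryVector n} (hv : v ∉ D)
    (h : (E : Set (BinaryVector n)) =
      (D : Set (BinaryVector n)) ∪ (fun c => v + c) '' (D : Set (BinaryVector n))) :
    Module.finrank (ZMod 2) E = Module.finrank (ZMod 2) D + 1 := by
  have h1 := natCard_eq_two_pow E
  rw [h, Set.ncard_union_eq, Set.ncard_image_of_injective _ (add_right_injective v),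
    natCard_eq_two_pow, ← two_mul, ← pow_succ'] at h1
  · exact (Nat.pow_right_injective le_rfl h1).symm
  · rw [Set.disjoint_left]
    intro x hx hx'
    rw [mem_image_add_iff] at hx'
    exact hv ((Submodule.add_mem_iff_left D hx).1 hx')

/-- The code generated by the doubly even part of `C` and a vector of the shadow. -/
def shadowNeighbor (C : BinaryCode n) (h : IsSelfDual C) (v : BinaryVector n) : BinaryCode n where
  carrier := doublyEvenPart C ∪ (fun c => v + c) '' doublyEvenPart C
  zero_mem' := Or.inl ⟨C.zero_mem, by simp⟩
  add_mem' := by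
    have hadd : ∀ x y, x ∈ doublyEvenPart C → y ∈ doublyEvenPart C → x + y ∈ doublyEvenPart C :=
      fun x y hx hy => (doublyEvenSubcode C h).add_mem hx hy
    intro a b ha hb
    simp only [Set.mem_union, mem_image_add_iff] at ha hb ⊢
    rcases ha with ha | ha <;> rcases hb with hb | hb
    · exact Or.inl (hadd _ _ ha hb)
    · right
      have := hadd _ _ ha hb
      rwa [add_left_comm] at this
    · right
      have := hadd _ _ ha hb
      rwa [add_assoc] at this
    · left
      have := hadd _ _ ha hb
      rwa [add_add_add_comm, add_self_vector, zero_add] at this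
  smul_mem' := by
    intro c x hx
    rcases eq_or_ne c 0 with rfl | hc
    · exact Or.inl ⟨by simp, by simp⟩
    · rw [zmod_two_ne_zero] at hc
      subst hc
      simpa using hx

theorem mem_shadowNeighbor {C : BinaryCode n} {h : IsSelfDual C} {v x : BinaryVector n} :
    x ∈ shadowNeighbor C h v ↔ x ∈ doublyEvenPart C ∨ v + x ∈ doublyEvenPart C := by
  rw [← mem_image_add_iff]
  rfl

section Neighbor

variable {C : BinaryCode n} {v : BinaryVector n}

/-- All of `v + C₀` has weight congruent to that of `v`, namely 2 modulo 4, so the new coset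
contributes nothing. -/
theorem doublyEvenPart_shadowNeighbor (hC : IsSinglyEvenSelfDual C) (hv : v ∈ shadow C)
    (hv' : hammingNorm v % 4 = 2) :
    doublyEvenPart (shadowNeighbor C hC.1 v) = doublyEvenPart C := by
  have hv0 := (isHalfWeightVector_iff_mem_shadow hC).2 hv
  ext x
  rw [mem_doublyEvenPart, mem_shadowNeighbor]
  constructor
  · rintro ⟨hx | hx, hx4⟩
    · exact hx
    · have := hv0.hammingNorm_add_mod hC.1 hx.1
      rw [← add_assoc, add_self_vector, zero_add] at this
      omega
  · exact fun hx => ⟨Or.inl hx, hx.2⟩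

theorem isSelfDual_shadowNeighbor (hC : IsSinglyEvenSelfDual C) (hv : v ∈ shadow C)
    (hv' : hammingNorm v % 4 = 2) : IsSelfDual (shadowNeighbor C hC.1 v) := by
  have hv0 := (isHalfWeightVector_iff_mem_shadow hC).2 hv
  have hvv : v ⬝ᵥ v = 0 := by
    rw [dotProduct_self_eq, natCast_zmod_two_eq_zero]
    omega
  have hvc : ∀ c ∈ doublyEvenPart C, v ⬝ᵥ c = 0 := hv.1
  have hcc : ∀ c ∈ doublyEvenPart C, ∀ d ∈ doublyEvenPart C, c ⬝ᵥ d = 0 :=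
    fun c hc d hd => hC.1.dotProduct_eq_zero hc.1 hd.1
  have hrep : ∀ x, v + x ∈ doublyEvenPart C → ∃ c ∈ doublyEvenPart C, x = v + c := fun x hx =>
    ⟨v + x, hx, by rw [← add_assoc, add_self_vector, zero_add]⟩
  refine le_antisymm ?_ ?_
  · intro x hx y hy
    rw [SetLike.mem_coe] at hy
    rw [mem_shadowNeighbor] at hx hy
    rcases hx with hx | hx <;> rcases hy with hy | hy
    · exact hcc x hx y hy
    · obtain ⟨c, hc, rfl⟩ := hrep _ hy
      rw [dotProduct_add, hcc x hx c hc, dotProduct_comm, hvc x hx, add_zero]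
    · obtain ⟨c, hc, rfl⟩ := hrep _ hx
      rw [add_dotProduct, hcc c hc y hy, hvc y hy, add_zero]
    · obtain ⟨c, hc, rfl⟩ := hrep _ hx
      obtain ⟨d, hd, rfl⟩ := hrep _ hy
      rw [add_dotProduct, dotProduct_add, dotProduct_add, hcc c hc d hd, hvc d hd,
        dotProduct_comm c v, hvc c hc, hvv]
      simp
  · intro x hx
    have hx0 : x ∈ dual (doublyEvenPart C) := fun y hy => hx y (mem_shadowNeighbor.2 (Or.inl hy))
    have hxv : v ⬝ᵥ x = 0 := by
      rw [dotProduct_comm]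
      refine hx v (mem_shadowNeighbor.2 (Or.inr ?_))
      rw [add_self_vector]
      exact ⟨C.zero_mem, by simp⟩
    rw [mem_shadowNeighbor]
    rcases (mem_dual_doublyEvenPart_iff hC.1).1 hx0 with hxC | hxS
    · exact Or.inl ⟨hxC, (hv0 x hxC).1 hxv⟩
    · have hvx := (mem_shadow_iff hC hv).1 hxS
      refine Or.inr ⟨hvx, (hv0 _ hvx).1 ?_⟩
      rw [dotProduct_add, hvv, hxv, add_zero]

theorem mem_shadowNeighbor_self (h : IsSelfDual C) : v ∈ shadowNeighbor C h v := by
  refine mem_shadowNeighbor.2 (Or.inr ?_)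
  rw [add_self_vector]
  exact ⟨C.zero_mem, by simp⟩

theorem isSinglyEvenSelfDual_shadowNeighbor (hC : IsSinglyEvenSelfDual C) (hv : v ∈ shadow C)
    (hv' : hammingNorm v % 4 = 2) : IsSinglyEvenSelfDual (shadowNeighbor C hC.1 v) :=
  ⟨isSelfDual_shadowNeighbor hC hv hv', v, mem_shadowNeighbor_self hC.1, hv'⟩

/-- Since `C₀` is unchanged, so is its dual; removing the neighbor leaves `C₂` and the half of the
old shadow that was not adjoined. -/
theorem mem_shadow_shadowNeighbor (hC : IsSinglyEvenSelfDual C) (hv : v ∈ shadow C)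
    (hv' : hammingNorm v % 4 = 2) {x : BinaryVector n} :
    x ∈ shadow (shadowNeighbor C hC.1 v) ↔
      (x ∈ C ∧ x ∉ doublyEvenPart C) ∨ (x ∈ shadow C ∧ v + x ∉ doublyEvenPart C) := by
  rw [shadow, doublyEvenPart_shadowNeighbor hC hv hv', Set.mem_sdiff, SetLike.mem_coe,
    SetLike.mem_coe, mem_dual_doublyEvenPart_iff hC.1, mem_shadowNeighbor]
  have h1 : x ∈ doublyEvenPart C → x ∈ C := fun h => h.1
  have h2 : v + x ∈ doublyEvenPart C → x ∈ shadow C := fun h => (mem_shadow_iff hC hv).2 h.1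
  have h3 : x ∈ shadow C → x ∉ C := fun h => h.2
  tauto

theorem finrank_doublyEvenSubcode (hC : IsSinglyEvenSelfDual C) :
    Module.finrank (ZMod 2) C = Module.finrank (ZMod 2) (doublyEvenSubcode C hC.1) + 1 := by
  obtain ⟨t, ht, ht'⟩ := hC.2
  refine finrank_eq_add_one (v := t) (fun h => ?_) ?_
  · have := h.2
    omega
  · ext c
    rw [Set.mem_union, mem_image_add_iff]
    change c ∈ C ↔ c ∈ doublyEvenPart C ∨ t + c ∈ doublyEvenPart C
    constructor
    · intro hc
      rw [mem_doublyEvenPart_add_iff hC.1 ht ht' hc]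
      exact em _
    · rintro (hc | hc)
      · exact hc.1
      · exact (Submodule.add_mem_iff_right C ht).1 hc.1

theorem finrank_shadowNeighbor (hC : IsSinglyEvenSelfDual C) (hv : v ∈ shadow C) :
    Module.finrank (ZMod 2) (shadowNeighbor C hC.1 v) = Module.finrank (ZMod 2) C := by
  rw [finrank_doublyEvenSubcode hC]
  exact finrank_eq_add_one (v := v) (fun h => hv.2 h.1) rfl

theorem isNeighbor_shadowNeighbor (hC : IsSinglyEvenSelfDual C) (hv : v ∈ shadow C)
    (hv' : hammingNorm v % 4 = 2) (hn : Module.finrank (ZMod 2) C = n / 2) :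
    IsNeighbor C (shadowNeighbor C hC.1 v) := by
  refine ⟨hC.1, isSelfDual_shadowNeighbor hC hv hv', ?_⟩
  have : C ⊓ shadowNeighbor C hC.1 v = doublyEvenSubcode C hC.1 := by
    ext x
    rw [Submodule.mem_inf, mem_shadowNeighbor]
    change _ ↔ x ∈ doublyEvenPart C
    constructor
    · rintro ⟨hxC, hx | hx⟩
      · exact hx
      · exact absurd hxC ((mem_shadow_iff hC hv).2 hx.1).2
    · exact fun hx => ⟨hx.1, Or.inl hx⟩
  rw [this, ← hn, finrank_doublyEvenSubcode hC]

end Neighbor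

end BinaryCode

/-! ### MacWilliams identities and the weights of the shadow modulo 4 -/

namespace BinaryCode

open Polynomial

variable {n : ℕ}

/-- The nontrivial character of the binary field. -/
noncomputable def signChar (a : ZMod 2) : ℂ := if a = 0 then 1 else -1

@[simp] theorem signChar_zero : signChar 0 = 1 := by simp [signChar]

@[simp] theorem signChar_one : signChar 1 = -1 := by simp [signChar]

theorem signChar_add (a b : ZMod 2) : signChar (a + b) = signChar a * signChar b := by
  rcases zmod_two_eq_zero_or_eq_one a with rfl | rfl <;>
    rcases zmod_two_eq_zero_or_eq_one b with rfl | rfl <;> simp [CharTwo.add_self_eq_zero]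

theorem signChar_sum {ι : Type*} (s : Finset ι) (f : ι → ZMod 2) :
    signChar (∑ i ∈ s, f i) = ∏ i ∈ s, signChar (f i) := by
  classical
  induction s using Finset.induction_on with
  | empty => simp
  | insert a s ha ih => rw [Finset.sum_insert ha, Finset.prod_insert ha, signChar_add, ih]

section Form

variable {R : Type*} [CommRing R] [Algebra ℂ R]

/-- The homogeneous weight enumerator of a complex-valued function on vectors. -/
noncomputable def weightForm (φ : BinaryVector n → ℂ) (x y : R) : R :=
  ∑ u, φ u • (x ^ (n - hammingNorm u) * y ^ hammingNorm u)

/-- The Fourier transform of a complex-valued function on vectors. -/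
noncomputable def fourierTransform (φ : BinaryVector n → ℂ) (w : BinaryVector n) : ℂ :=
  ∑ u, φ u * signChar (u ⬝ᵥ w)

theorem prod_ite_eq_pow {R : Type*} [CommRing R] (u : BinaryVector n) (x y : R) :
    ∏ i, (if u i = 0 then x else y) = x ^ (n - hammingNorm u) * y ^ hammingNorm u := by
  rw [Finset.prod_ite, Finset.prod_const, Finset.prod_const]
  have h : (Finset.univ.filter fun i => u i = 0).card + hammingNorm u = n := by
    rw [hammingNorm, Finset.card_filter_add_card_filter_not]
    simp
  congr 2
  omega

/-- The MacWilliams identity: each monomial is a product over coordinates, and expanding the product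
of `x ± y` yields the characters of `F₂ⁿ`. -/
theorem weightForm_add_sub (φ : BinaryVector n → ℂ) (x y : R) :
    weightForm φ (x + y) (x - y) = weightForm (fourierTransform φ) x y := by
  have key : ∀ u : BinaryVector n, (x + y) ^ (n - hammingNorm u) * (x - y) ^ hammingNorm u =
      ∑ w : BinaryVector n,
        signChar (u ⬝ᵥ w) • (x ^ (n - hammingNorm w) * y ^ hammingNorm w) := by
    intro u
    have h : ∀ i, (if u i = 0 then x + y else x - y) =
        ∑ a : ZMod 2, signChar (u i * a) • (if a = 0 then x else y) := by
      intro i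
      have : (Finset.univ : Finset (ZMod 2)) = {0, 1} := rfl
      rw [this, Finset.sum_pair zero_ne_one]
      rcases zmod_two_eq_zero_or_eq_one (u i) with h | h <;> simp [h, sub_eq_add_neg]
    rw [← prod_ite_eq_pow, Finset.prod_congr rfl fun i _ => h i, Fintype.prod_sum]
    refine Finset.sum_congr rfl fun w _ => ?_
    rw [Finset.prod_smul, prod_ite_eq_pow, dotProduct, signChar_sum]
  simp only [weightForm, key, fourierTransform, Finset.smul_sum, Finset.sum_smul, smul_smul]
  rw [Finset.sum_comm]

theorem weightForm_const_mul (a : ℂ) (φ : BinaryVector n → ℂ) (x y : R) :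
    weightForm (fun u => a * φ u) x y = a • weightForm φ x y := by
  simp only [weightForm, Finset.smul_sum, smul_smul]

theorem pow_dvd_weightForm {φ : BinaryVector n → ℂ} {s : ℕ}
    (h : ∀ u, φ u ≠ 0 → s ≤ hammingNorm u) (x y : R) : y ^ s ∣ weightForm φ x y := by
  refine Finset.dvd_sum fun u _ => ?_
  by_cases hu : φ u = 0
  · simp [hu]
  · rw [Algebra.smul_def]
    exact ((pow_dvd_pow y (h u hu)).mul_left _).mul_left _

theorem weightForm_mul (φ : BinaryVector n → ℂ) (a x y : R) :
    weightForm φ (a * x) (a * y) = a ^ n * weightForm φ x y := by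
  rw [weightForm, weightForm, Finset.mul_sum]
  refine Finset.sum_congr rfl fun u _ => ?_
  have h : hammingNorm u ≤ n := by simpa using hammingNorm_le_card_fintype (x := u)
  rw [mul_pow, mul_pow, mul_smul_comm]
  have ha : a ^ n = a ^ (n - hammingNorm u) * a ^ hammingNorm u := by
    rw [← pow_add, Nat.sub_add_cancel h]
  rw [ha]
  congr 1
  ring

theorem aeval_weightForm (φ : BinaryVector n → ℂ) (p q : ℂ[X]) (z : R) :
    aeval z (weightForm φ p q) = weightForm φ (aeval z p) (aeval z q) := by
  simp [weightForm]

end Form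

open Classical in
/-- The function equal to the character `c ↦ (-1) ^ (b ⬝ᵥ c)` transported to the coset `v + C`,
and to zero off this coset. -/
noncomputable def cosetChar (C : BinaryCode n) (v b : BinaryVector n) (u : BinaryVector n) : ℂ :=
  if v + u ∈ C then signChar (b ⬝ᵥ (v + u)) else 0

open Classical in
theorem IsSelfDual.sum_signChar {C : BinaryCode n} (h : IsSelfDual C) (w : BinaryVector n) :
    ∑ u, (if u ∈ C then signChar (u ⬝ᵥ w) else 0) =
      if w ∈ C then (2 : ℂ) ^ Module.finrank (ZMod 2) C else 0 := by
  split_ifs with hw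
  · have h1 : ∀ u, (if u ∈ C then signChar (u ⬝ᵥ w) else 0) = if u ∈ C then (1 : ℂ) else 0 := by
      intro u
      split_ifs with hu
      · rw [h.dotProduct_eq_zero hu hw, signChar_zero]
      · rfl
    rw [Finset.sum_congr rfl fun u _ => h1 u, Finset.sum_boole]
    have h2 := natCard_eq_two_pow C
    rw [Set.ncard_eq_toFinset_card'] at h2
    have h3 : (Finset.univ.filter fun u => u ∈ C) = (C : Set (BinaryVector n)).toFinset := by
      ext; simp
    rw [h3, h2]
    simp
  · rw [h.mem_iff] at hw
    push Not at hw
    obtain ⟨y, hy, hwy⟩ := hw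
    have h1 : ∑ u, (if u ∈ C then signChar (u ⬝ᵥ w) else 0) =
        - ∑ u, (if u ∈ C then signChar (u ⬝ᵥ w) else 0) := by
      conv_lhs => rw [← Equiv.sum_comp (Equiv.addLeft y)]
      rw [← Finset.sum_neg_distrib]
      refine Finset.sum_congr rfl fun u _ => ?_
      rw [Equiv.coe_addLeft, Submodule.add_mem_iff_right C hy, add_dotProduct, signChar_add,
        dotProduct_comm y w, zmod_two_ne_zero.1 hwy]
      split_ifs <;> simp
    exact self_eq_neg.1 h1

-- The transform exchanges the translation `v` and the character `b`. Hence `v = b = 0` gives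
-- self-duality of the weight enumerator, `b = 0` the shadow identity, and `v = b` with `v ⬝ᵥ v = 0`
-- an eigenfunction.
open Classical in
theorem IsSelfDual.fourierTransform_cosetChar {C : BinaryCode n} (h : IsSelfDual C)
    (v b w : BinaryVector n) :
    fourierTransform (cosetChar C v b) w =
      if b + w ∈ C then (2 : ℂ) ^ Module.finrank (ZMod 2) C * signChar (v ⬝ᵥ w) else 0 := by
  rw [fourierTransform, ← Equiv.sum_comp (Equiv.addLeft v)]
  have h1 : ∀ u, cosetChar C v b (v + u) * signChar ((v + u) ⬝ᵥ w) =
      (if u ∈ C then signChar (u ⬝ᵥ (b + w)) else 0) * signChar (v ⬝ᵥ w) := by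
    intro u
    rw [cosetChar, ← add_assoc, add_self_vector, zero_add]
    split_ifs
    · rw [add_dotProduct, dotProduct_add, signChar_add, signChar_add, dotProduct_comm b u]
      ring
    · simp
  simp only [Equiv.coe_addLeft, h1]
  rw [← Finset.sum_mul, h.sum_signChar]
  split_ifs <;> simp

theorem IsHalfWeightVector.signChar_eq {C : BinaryCode n} (h : IsSelfDual C)
    {v c : BinaryVector n} (hv : IsHalfWeightVector C v) (hc : c ∈ C) :
    signChar (v ⬝ᵥ c) = Complex.I ^ hammingNorm c := by
  have h2 := h.hammingNorm_mod_two hc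
  rw [Complex.I_pow_eq_pow_mod]
  by_cases hc4 : hammingNorm c % 4 = 0
  · rw [(hv c hc).2 hc4, hc4, signChar_zero, pow_zero]
  · have h3 : hammingNorm c % 4 = 2 := by omega
    rw [zmod_two_ne_zero.1 (mt (hv c hc).1 hc4), h3, signChar_one, Complex.I_sq]

theorem mod_four_eq_of_I_pow_eq {a b : ℕ} (h : Complex.I ^ a = Complex.I ^ b) :
    a % 4 = b % 4 := by
  rw [Complex.I_pow_eq_pow_mod, Complex.I_pow_eq_pow_mod b] at h
  have ha : a % 4 < 4 := Nat.mod_lt _ (by norm_num)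
  have hb : b % 4 < 4 := Nat.mod_lt _ (by norm_num)
  generalize a % 4 = r at *
  generalize b % 4 = t at *
  interval_cases r <;> interval_cases t <;>
    first
    | rfl
    | (exfalso; norm_num [pow_succ, Complex.ext_iff] at h)

/-- On `C` the character of a shadow vector is `c ↦ i ^ wt(c)`, which the substitution of `i y` for
`y` absorbs. -/
theorem weightForm_cosetChar_shadow {R : Type*} [CommRing R] [Algebra ℂ R]
    {C : BinaryCode n} (h : IsSelfDual C) {v : BinaryVector n} (hv : IsHalfWeightVector C v)
    (x y : R) :
    weightForm (cosetChar C v 0) (x + y) (x - y) =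
      (2 : ℂ) ^ Module.finrank (ZMod 2) C • weightForm (cosetChar C 0 0) x (Complex.I • y) := by
  rw [weightForm_add_sub, ← weightForm_const_mul, weightForm, weightForm]
  refine Finset.sum_congr rfl fun u _ => ?_
  rw [h.fourierTransform_cosetChar, cosetChar, zero_add, _root_.smul_pow, mul_smul_comm, smul_smul]
  split_ifs with hu
  · rw [hv.signChar_eq h hu, zero_dotProduct, signChar_zero, mul_one]
  · simp

theorem IsHalfWeightVector.hammingNorm_mod_four {C : BinaryCode n} (h : IsSelfDual C)
    {v : BinaryVector n} (hv : IsHalfWeightVector C v)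
    (hn : n = 2 * Module.finrank (ZMod 2) C) :
    hammingNorm v % 4 = Module.finrank (ZMod 2) C % 4 := by
  classical
  refine mod_four_eq_of_I_pow_eq ?_
  have hI := Complex.I_mul_I
  have hone : ∀ w : BinaryVector n, ∑ u, cosetChar C w 0 u =
      (2 : ℂ) ^ Module.finrank (ZMod 2) C := by
    intro w
    have := h.fourierTransform_cosetChar w 0 0
    simpa [fourierTransform] using this
  -- At this point the left side is the sum of `i ^ wt(u)` over the shadow, where all terms are
  -- equal. On the right both arguments become `(1+i)/2`, whose square is `i/2`, leaving `i ^ m`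
  -- times a power of 2.
  have key := weightForm_cosetChar_shadow h hv ((1 + Complex.I) / 2) ((1 - Complex.I) / 2)
  have e1 : (1 + Complex.I) / 2 + (1 - Complex.I) / 2 = 1 := by ring
  have e2 : (1 + Complex.I) / 2 - (1 - Complex.I) / 2 = Complex.I := by ring
  have e3 : Complex.I • ((1 - Complex.I) / 2) = (1 + Complex.I) / 2 := by
    rw [smul_eq_mul]; linear_combination (-1 / 2) * hI
  rw [e1, e2, e3] at key
  have e4 := weightForm_mul (cosetChar C 0 0) ((1 + Complex.I) / 2) 1 1
  rw [mul_one] at e4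
  rw [e4] at key
  have l : weightForm (cosetChar C v 0) 1 Complex.I =
      Complex.I ^ hammingNorm v * 2 ^ Module.finrank (ZMod 2) C := by
    rw [← hone v, weightForm, Finset.mul_sum]
    refine Finset.sum_congr rfl fun u _ => ?_
    rw [cosetChar]
    split_ifs with hu
    · have := hv.hammingNorm_add_mod h hu
      rw [← add_assoc, add_self_vector, zero_add] at this
      rw [Complex.I_pow_eq_pow_mod, this, ← Complex.I_pow_eq_pow_mod]
      simp
    · simp
  have r : weightForm (cosetChar C 0 0) (1 : ℂ) 1 = 2 ^ Module.finrank (ZMod 2) C := by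
    rw [← hone 0, weightForm]
    simp
  rw [l, r, smul_eq_mul, mul_comm] at key
  have h2 : (2 : ℂ) ^ Module.finrank (ZMod 2) C ≠ 0 := pow_ne_zero _ two_ne_zero
  rw [mul_left_cancel₀ h2 key]
  conv_lhs => enter [1, 2]; rw [hn]
  rw [pow_mul, ← mul_pow]
  congr 1
  linear_combination (1 / 2) * hI

end BinaryCode

/-! ### The two halves of the shadow have equal weight enumerators -/

namespace BinaryCode

open Polynomial

variable {n : ℕ}

theorem aeval_C_mul_X_weightForm {φ : BinaryVector n → ℂ} {ζ κ : ℂ}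
    (h : ∀ u, φ u ≠ 0 → ζ ^ hammingNorm u = κ) :
    aeval (C ζ * X : ℂ[X]) (weightForm φ (1 : ℂ[X]) X) = κ • weightForm φ (1 : ℂ[X]) X := by
  rw [aeval_weightForm, map_one, aeval_X, weightForm, weightForm, Finset.smul_sum]
  refine Finset.sum_congr rfl fun u _ => ?_
  by_cases hu : φ u = 0
  · simp [hu]
  · rw [mul_pow, ← C_pow, h u hu, ← smul_eq_C_mul, mul_smul_comm, smul_comm]

/-- A rotation `X ↦ ζX` that fixes `f` up to a nonzero scalar carries divisors of `f` to divisors of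
`f`. -/
theorem dvd_of_aeval_C_mul_X {p q f : ℂ[X]} {ζ κ : ℂ} (hκ : κ ≠ 0)
    (hf : aeval (C ζ * X : ℂ[X]) f = κ • f) (hpq : aeval (C ζ * X : ℂ[X]) p = q) (h : p ∣ f) :
    q ∣ f := by
  have := map_dvd (aeval (C ζ * X : ℂ[X])) h
  rw [hf, hpq, smul_eq_C_mul] at this
  exact (IsUnit.dvd_mul_left (isUnit_C.2 hκ.isUnit)).1 this

theorem dvd_of_dvd_smul {p f : ℂ[X]} {κ : ℂ} (hκ : κ ≠ 0) (h : p ∣ κ • f) : p ∣ f := by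
  rw [smul_eq_C_mul] at h
  exact (IsUnit.dvd_mul_left (isUnit_C.2 hκ.isUnit)).1 h

theorem isCoprime_one_sub_one_add (p : ℂ[X]) : IsCoprime (1 - p) (1 + p) := by
  refine ⟨C (1 / 2), C (1 / 2), ?_⟩
  have : (C (1 / 2) : ℂ[X]) * 2 = 1 := by
    rw [show (2 : ℂ[X]) = C 2 from rfl, ← C_mul]
    norm_num
  linear_combination this

/-- The form vanishes to order `s` at 0 by `hs` and at ∞ by `hs'`. The transform carries 0 to 1, and
rotation by `i`, available because the weights are 2 modulo 4, carries 1 to -1 and ±i. Six zeros of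
order `s` exceed the degree `n`. -/
theorem weightForm_eq_zero {φ : BinaryVector n → ℂ} {a : ℂ} (ha : a ≠ 0)
    (hφ : ∀ u, fourierTransform φ u = a * φ u) (h4 : ∀ u, φ u ≠ 0 → hammingNorm u % 4 = 2)
    {s : ℕ} (hs : ∀ u, φ u ≠ 0 → s ≤ hammingNorm u)
    (hs' : ∀ u, φ u ≠ 0 → hammingNorm u + s ≤ n) (hn : n < 6 * s) :
    weightForm φ (1 : ℂ[X]) X = 0 := by
  set f := weightForm φ (1 : ℂ[X]) X with hf
  have hX : (X : ℂ[X]) ^ s ∣ f := pow_dvd_weightForm hs 1 X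
  have h1 : (1 - X : ℂ[X]) ^ s ∣ f := by
    refine dvd_of_dvd_smul ha ?_
    rw [hf, ← weightForm_const_mul, ← funext hφ, ← weightForm_add_sub]
    exact pow_dvd_weightForm hs _ _
  have hneg : aeval (C (-1) * X : ℂ[X]) f = (1 : ℂ) • f := by
    refine aeval_C_mul_X_weightForm fun u hu => ?_
    have := h4 u hu
    exact Even.neg_one_pow (Nat.even_iff.2 (by omega))
  have hI : aeval (C Complex.I * X : ℂ[X]) f = (-1 : ℂ) • f := by
    refine aeval_C_mul_X_weightForm fun u hu => ?_
    rw [Complex.I_pow_eq_pow_mod, h4 u hu, Complex.I_sq]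
  have h2 : (1 + X : ℂ[X]) ^ s ∣ f :=
    dvd_of_aeval_C_mul_X one_ne_zero hneg (by simp) h1
  have h3 : (1 - X ^ 2 : ℂ[X]) ^ s ∣ f := by
    have := (isCoprime_one_sub_one_add X).pow (m := s) (n := s) |>.mul_dvd h1 h2
    rw [← mul_pow] at this
    convert this using 2
    ring
  have h5 : (1 + X ^ 2 : ℂ[X]) ^ s ∣ f := by
    refine dvd_of_aeval_C_mul_X (by norm_num) hI ?_ h3
    simp [mul_pow, ← C_pow]
  have h6 : (1 - X ^ 4 : ℂ[X]) ^ s ∣ f := by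
    have := (isCoprime_one_sub_one_add (X ^ 2)).pow (m := s) (n := s) |>.mul_dvd h3 h5
    rw [← mul_pow] at this
    convert this using 2
    ring
  have h7 : (X * (1 - X ^ 4) : ℂ[X]) ^ s ∣ f := by
    rw [mul_pow]
    refine IsCoprime.mul_dvd (IsCoprime.pow ⟨X ^ 3, 1, by ring⟩) hX h6
  by_contra hne
  have h8 := natDegree_le_of_dvd h7 hne
  have h9 : (X * (1 - X ^ 4) : ℂ[X]).natDegree = 5 := by
    have : (X * (1 - X ^ 4) : ℂ[X]) = C (-1) * X ^ 5 + C 1 * X := by simp; ring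
    rw [this]
    compute_degree!
  rw [natDegree_pow, h9] at h8
  -- This is the zero at ∞, which turns the contradictory inequality from `5 * s ≤ n` into `5 * s ≤
  -- n - s`.
  have h10 : f.natDegree ≤ n - s := by
    refine natDegree_sum_le_of_forall_le _ _ fun u _ => ?_
    by_cases hu : φ u = 0
    · simp [hu]
    · have := hs' u hu
      refine (natDegree_smul_le _ _).trans ?_
      rw [one_pow, one_mul, natDegree_X_pow]
      omega
  have h11 : s ≤ n := by
    by_contra hsn
    refine hne (Finset.sum_eq_zero fun u _ => ?_)
    have : φ u = 0 := by
      by_contra hu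
      have := hs' u hu
      omega
    rw [this, zero_smul]
  omega

theorem coeff_weightForm (φ : BinaryVector n → ℂ) (w : ℕ) :
    (weightForm φ (1 : ℂ[X]) X).coeff w =
      ∑ u, if hammingNorm u = w then φ u else 0 := by
  rw [weightForm, finsetSum_coeff]
  refine Finset.sum_congr rfl fun u _ => ?_
  simp [coeff_X_pow, eq_comm]

theorem IsSelfDual.one_mem {C : BinaryCode n} (h : IsSelfDual C) : (1 : BinaryVector n) ∈ C := by
  refine h.mem_iff.2 fun y hy => ?_
  rw [dotProduct_eq_natCast, one_mul, natCast_zmod_two_eq_zero]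
  exact h.hammingNorm_mod_two hy

theorem hammingNorm_one_add (u : BinaryVector n) : hammingNorm (1 + u) + hammingNorm u = n := by
  have h := hammingNorm_add_add 1 u
  have h1 : hammingNorm (1 : BinaryVector n) = n := by simp [hammingNorm]
  rw [one_mul, h1] at h
  omega

theorem cosetChar_self_eq {C : BinaryCode n} {v u : BinaryVector n}
    (hv : IsHalfWeightVector C v) :
    (v + u ∈ doublyEvenPart C → cosetChar C v v u = 1) ∧
      (v + u ∈ C → v + u ∉ doublyEvenPart C → cosetChar C v v u = -1) ∧
      (v + u ∉ C → cosetChar C v v u = 0) := by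
  refine ⟨fun h => ?_, fun h h' => ?_, fun h => ?_⟩
  · rw [cosetChar, if_pos h.1, (hv _ h.1).2 h.2, signChar_zero]
  · have : v ⬝ᵥ (v + u) ≠ 0 := fun h0 => h' ⟨h, (hv _ h).1 h0⟩
    rw [cosetChar, if_pos h, zmod_two_ne_zero.1 this, signChar_one]
  · rw [cosetChar, if_neg h]

/-- If the minimum weight of the shadow exceeds a sixth of the length, then both cosets of the
doubly even part in the shadow have the same weights. -/
theorem exists_hammingNorm_eq_iff {C : BinaryCode n} (hC : IsSinglyEvenSelfDual C)
    {v : BinaryVector n} (hv : v ∈ shadow C)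
    (h4 : ∀ u ∈ shadow C, hammingNorm u % 4 = 2)
    {s : ℕ} (hs : ∀ u ∈ shadow C, s ≤ hammingNorm u) (hn : n < 6 * s) (w : ℕ) :
    (∃ u ∈ shadow C, v + u ∈ doublyEvenPart C ∧ hammingNorm u = w) ↔
      ∃ u ∈ shadow C, v + u ∉ doublyEvenPart C ∧ hammingNorm u = w := by
  classical
  have hv0 := (isHalfWeightVector_iff_mem_shadow hC).2 hv
  have hS : ∀ {u}, v + u ∈ C ↔ u ∈ shadow C := fun {u} => (mem_shadow_iff hC hv).symm
  have hval := fun u => cosetChar_self_eq (u := u) hv0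
  have hsupp : ∀ u, cosetChar C v v u ≠ 0 → u ∈ shadow C := by
    intro u hu
    by_contra h
    exact hu ((hval u).2.2 fun h' => h (hS.1 h'))
  have hfour : ∀ u, fourierTransform (cosetChar C v v) u =
      2 ^ Module.finrank (ZMod 2) C * cosetChar C v v u := by
    intro u
    have hvv : v ⬝ᵥ v = 0 := by
      rw [dotProduct_self_eq, natCast_zmod_two_eq_zero]
      have := h4 v hv
      omega
    rw [hC.1.fourierTransform_cosetChar, cosetChar, dotProduct_add, hvv, zero_add]
    split_ifs <;> simp
  have hzero := weightForm_eq_zero (pow_ne_zero _ two_ne_zero) hfour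
    (fun u hu => h4 u (hsupp u hu)) (fun u hu => hs u (hsupp u hu)) (fun u hu => ?_) hn
  swap
  -- The all-ones vector lies in `C`, so complementation preserves the shadow and bounds its weights
  -- from above by `n - s`.
  · have h1 : 1 + u ∈ shadow C := by
      rw [← hS, add_left_comm]
      exact C.add_mem hC.1.one_mem (hS.2 (hsupp u hu))
    have h2 := hs _ h1
    have h3 := hammingNorm_one_add u
    omega
  -- The coefficient at `w` is the number of vectors of weight `w` in `v + C₀` minus the number in
  -- the other half.
  have hsum := coeff_weightForm (cosetChar C v v) w
  rw [hzero, coeff_zero] at hsum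
  have hcases : ∀ u, (if hammingNorm u = w then cosetChar C v v u else 0) =
      ((if hammingNorm u = w ∧ u ∈ shadow C ∧ v + u ∈ doublyEvenPart C then 1 else 0) : ℂ) -
        (if hammingNorm u = w ∧ u ∈ shadow C ∧ v + u ∉ doublyEvenPart C then 1 else 0) := by
    intro u
    by_cases hw : hammingNorm u = w
    · by_cases hu : u ∈ shadow C
      · by_cases hd : v + u ∈ doublyEvenPart C
        · simp [hw, hu, hd, (hval u).1 hd]
        · simp [hw, hu, hd, (hval u).2.1 (hS.2 hu) hd]
      · simp [hw, hu, (hval u).2.2 fun h' => hu (hS.1 h')]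
    · simp [hw]
  rw [Finset.sum_congr rfl fun u _ => hcases u, Finset.sum_sub_distrib, Finset.sum_boole,
    Finset.sum_boole, eq_comm, sub_eq_zero, Nat.cast_inj] at hsum
  have hpos : ∀ p : BinaryVector n → Prop,
      0 < (Finset.univ.filter fun u => hammingNorm u = w ∧ u ∈ shadow C ∧ p u).card ↔
        ∃ u ∈ shadow C, p u ∧ hammingNorm u = w := by
    intro p
    rw [Finset.card_pos]
    constructor
    · rintro ⟨u, hu⟩
      rw [Finset.mem_filter] at hu
      exact ⟨u, hu.2.2.1, hu.2.2.2, hu.2.1⟩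
    · rintro ⟨u, h1, h2, h3⟩
      exact ⟨u, Finset.mem_filter.2 ⟨Finset.mem_univ _, h3, h1, h2⟩⟩
  rw [← hpos, ← hpos]
  refine iff_of_eq (congrArg _ ?_)
  convert hsum

end BinaryCode

/-! ### Lagrange inversion and a nonvanishing coefficient -/

namespace PowerSeries

/-- With `z = X * k` and `h = X / z`, this coefficient is the residue of `d(z^j) / z^(j+r+1)`, a
constant times the exact form `d(z^(-r-1))`. Characteristic zero permits division by `r + 1`. -/
theorem coeff_derivative_X_mul_pow_mul_pow {K : Type*} [Field K] [CharZero K] {h k : K⟦X⟧}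
    (hk : h * k = 1) (j r : ℕ) :
    coeff (j + r) (d⁄dX K ((X * k) ^ j) * h ^ (j + r + 1)) = 0 := by
  have e : (X * k) ^ j * h ^ (j + r + 1) = X ^ j * h ^ (r + 1) := by
    have : (h * k) ^ j = 1 := by rw [hk, one_pow]
    linear_combination X ^ j * h ^ (r + 1) * this
  have e' : (X * k) ^ j * h ^ (j + r) = X ^ j * h ^ r := by
    have : (h * k) ^ j = 1 := by rw [hk, one_pow]
    linear_combination X ^ j * h ^ r * this
  have d := congrArg (d⁄dX K) e
  rw [Derivation.leibniz, smul_eq_mul, smul_eq_mul, derivative_pow h] at d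
  have c1 : coeff (j + r) (d⁄dX K (X ^ j * h ^ (r + 1))) =
      coeff (r + 1) (h ^ (r + 1)) * (j + r + 1) := by
    rw [coeff_derivative, add_assoc j r 1, coeff_X_pow_mul', if_pos (by omega)]
    simp
  have c2 : coeff (j + r) (X ^ j * d⁄dX K (h ^ (r + 1))) =
      coeff (r + 1) (h ^ (r + 1)) * (r + 1) := by
    rw [coeff_X_pow_mul', if_pos (by omega), Nat.add_sub_cancel_left, coeff_derivative]
  rw [derivative_pow] at c2
  have key : (C ((r : K) + 1)) * (d⁄dX K ((X * k) ^ j) * h ^ (j + r + 1)) =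
      C ((r : K) + 1) * d⁄dX K (X ^ j * h ^ (r + 1)) -
        C ((j : K) + r + 1) * (X ^ j * (((r + 1 : ℕ) : K⟦X⟧) * h ^ (r + 1 - 1) * d⁄dX K h)) := by
    rw [← d]
    simp only [map_add, map_natCast, map_one, Nat.add_sub_cancel]
    push_cast
    linear_combination (-(r : K⟦X⟧) - 1) * (j + r + 1) * d⁄dX K h * e'
  have := congrArg (coeff (j + r)) key
  rw [map_sub, coeff_C_mul, coeff_C_mul, coeff_C_mul, c1, c2] at this
  have hr : (r : K) + 1 ≠ 0 := by exact_mod_cast Nat.succ_ne_zero r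
  refine (mul_eq_zero.1 (this.trans ?_)).resolve_left hr
  ring

/-- The expansion of `(1 - X ^ 2)⁻¹`. -/
noncomputable def evenGeometric (R : Type*) [Semiring R] : R⟦X⟧ :=
  mk fun n => if Even n then 1 else 0

theorem evenGeometric_mul {R : Type*} [CommRing R] : (1 - X ^ 2) * evenGeometric R = 1 := by
  ext n
  rw [sub_mul, one_mul, map_sub, coeff_X_pow_mul', coeff_one]
  rcases n with _ | _ | n
  · simp [evenGeometric]
  · simp [evenGeometric]
  · simp [evenGeometric, Nat.even_add]

theorem map_evenGeometric {R S : Type*} [Semiring R] [Semiring S] (f : R →+* S) :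
    map f (evenGeometric R) = evenGeometric S := by
  ext n
  simp [evenGeometric]

theorem one_add_X_mul_evenGeometric {R : Type*} [Semiring R] :
    (1 + X) * evenGeometric R = mk fun _ => 1 := by
  ext n
  rw [add_mul, one_mul, map_add]
  rcases n with _ | n
  · simp [evenGeometric]
  · rw [coeff_succ_X_mul]
    simp only [evenGeometric, coeff_mk, Nat.even_add_one]
    split_ifs <;> simp

/-- All factors have natural number coefficients and constant term 1, and one factor, `(1+X)/(1-X²)
= 1/(1-X)`, has every coefficient equal to 1; nothing can cancel. -/
theorem coeff_evenGeometric_product_ne_zero (K : Type*) [Field K] [CharZero K] (k m : ℕ) :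
    coeff m ((1 + X) * evenGeometric K ^ k * ((1 + X) * evenGeometric K) ^ 4) ≠ 0 := by
  have hmap : (1 + X) * evenGeometric K ^ k * ((1 + X) * evenGeometric K) ^ 4 =
      map (Nat.castRingHom K)
        ((1 + X) * evenGeometric ℕ ^ k * ((1 + X) * evenGeometric ℕ) ^ 3 *
          ((1 + X) * evenGeometric ℕ)) := by
    simp only [map_mul, map_pow, map_add, map_one, map_X, map_evenGeometric]
    ring
  rw [hmap, coeff_map]
  simp only [eq_natCast, Nat.cast_ne_zero]
  rw [coeff_mul]
  refine (Finset.sum_pos' (fun _ _ => Nat.zero_le _) ⟨(0, m), by simp, ?_⟩).ne'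
  rw [one_add_X_mul_evenGeometric]
  simp [evenGeometric]

end PowerSeries

-- Dividing by `(1+X)^(12k+6)` makes the left side a polynomial of degree at most `2k+1` in `z =
-- X(1-X)²/(1+X)⁴`. So the coefficient of `z^(2k+2)` in the expansion of `(1+X)^(-12k-6)` would be
-- zero. By Lagrange inversion it is a nonzero multiple of a coefficient that cannot vanish.
open PowerSeries in
theorem octahedral_expansion_ne (k : ℕ) (a : ℕ → ℂ) (R : ℂ⟦X⟧) :
    (1 + X : ℂ⟦X⟧) ^ (4 * k + 2) * ∑ j ∈ Finset.range (2 * k + 2),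
      C (a j) * ((1 + X) ^ (4 * (2 * k + 1 - j)) * (X * (1 - X) ^ 2) ^ j) ≠
        1 + X ^ (2 * k + 3) * R := by
  intro heq
  set E : ℂ⟦X⟧ := evenGeometric ℂ with hE
  have hE1 : (1 - X ^ 2) * E = 1 := evenGeometric_mul
  set u : ℂ⟦X⟧ := 1 + X with hu
  set w : ℂ⟦X⟧ := 1 - X with hw
  -- `U`, `V` and `E` are the inverses of `1 + X`, `1 - X` and `1 - X²`.
  set U := w * E with hU
  set V := u * E with hV
  have huU : u * U = 1 := by rw [← hE1, hU, hu, hw]; ring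
  have hwV : w * V = 1 := by rw [← hE1, hV, hu, hw]; ring
  have hUV : U * V = E := by
    calc U * V = (u * U) * E := by rw [hV]; ring
      _ = E := by rw [huU, one_mul]
  clear_value U V u w E
  have huUp : ∀ i, u ^ i * U ^ i = 1 := fun i => by rw [← mul_pow, huU, one_pow]
  have hhk : (u ^ 4 * V ^ 2) * (w ^ 2 * U ^ 4) = 1 := by
    calc _ = (u * U) ^ 4 * (w * V) ^ 2 := by ring
      _ = 1 := by rw [huU, hwV]; simp
  have hsum : ∑ j ∈ Finset.range (2 * k + 2), C (a j) * (X * (w ^ 2 * U ^ 4)) ^ j =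
      U ^ (12 * k + 6) + X ^ (2 * k + 3) * (R * U ^ (12 * k + 6)) := by
    have := congrArg (· * U ^ (12 * k + 6)) heq
    simp only [add_mul, one_mul] at this
    rw [← mul_assoc (X ^ (2 * k + 3)), ← this, mul_right_comm (u ^ (4 * k + 2)),
      Finset.mul_sum]
    refine Finset.sum_congr rfl fun j hj => ?_
    rw [Finset.mem_range] at hj
    have h1 : u ^ (4 * k + 2) * U ^ (12 * k + 6) * u ^ (4 * (2 * k + 1 - j)) = U ^ (4 * j) := by
      have e1 : 12 * k + 6 = (4 * k + 2) + 4 * (2 * k + 1 - j) + 4 * j := by omega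
      rw [e1, pow_add, pow_add]
      linear_combination U ^ (4 * j) * u ^ (4 * (2 * k + 1 - j)) *
        U ^ (4 * (2 * k + 1 - j)) * huUp (4 * k + 2) + U ^ (4 * j) * huUp (4 * (2 * k + 1 - j))
    calc C (a j) * (X * (w ^ 2 * U ^ 4)) ^ j = C (a j) * (U ^ (4 * j) * (X * w ^ 2) ^ j) := by
          rw [pow_mul, ← mul_pow]; congr 2; ring
      _ = _ := by rw [← h1]; ring
  have hdU : d⁄dX ℂ U = -U ^ 2 := by
    have h1 := congrArg (d⁄dX ℂ) huU
    rw [Derivation.leibniz, smul_eq_mul, smul_eq_mul, derivative_one, hu, map_add,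
      derivative_one, derivative_X, ← hu] at h1
    linear_combination U * h1 - d⁄dX ℂ U * huU
  -- This functional extracts `2k+2` times the coefficient of `z^(2k+2)`: it kills lower powers of
  -- `z` and anything divisible by `X^(2k+3)`.
  have hd := congrArg (fun f => coeff (2 * k + 1) (d⁄dX ℂ f * (u ^ 4 * V ^ 2) ^ (2 * k + 2))) hsum
  have hzero : coeff (2 * k + 1) (d⁄dX ℂ (∑ j ∈ Finset.range (2 * k + 2),
      C (a j) * (X * (w ^ 2 * U ^ 4)) ^ j) * (u ^ 4 * V ^ 2) ^ (2 * k + 2)) = 0 := by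
    rw [map_sum, Finset.sum_mul, map_sum]
    refine Finset.sum_eq_zero fun j hj => ?_
    rw [Finset.mem_range] at hj
    obtain ⟨r, hr⟩ : ∃ r, 2 * k + 1 = j + r := ⟨2 * k + 1 - j, by omega⟩
    have := coeff_derivative_X_mul_pow_mul_pow hhk j r
    rw [← hr] at this
    rw [Derivation.leibniz, derivative_C, smul_zero, add_zero, smul_eq_mul, mul_assoc,
      coeff_C_mul, this, mul_zero]
  have htail : coeff (2 * k + 1) (d⁄dX ℂ (X ^ (2 * k + 3) * (R * U ^ (12 * k + 6))) *
      (u ^ 4 * V ^ 2) ^ (2 * k + 2)) = 0 := by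
    have : ∃ Q, d⁄dX ℂ (X ^ (2 * k + 3) * (R * U ^ (12 * k + 6))) = X ^ (2 * k + 2) * Q := by
      refine ⟨X * d⁄dX ℂ (R * U ^ (12 * k + 6)) +
        ((2 * k + 3 : ℕ) : ℂ⟦X⟧) * (R * U ^ (12 * k + 6)), ?_⟩
      rw [Derivation.leibniz, derivative_pow, derivative_X, smul_eq_mul, smul_eq_mul,
        show 2 * k + 3 - 1 = 2 * k + 2 by omega]
      ring
    obtain ⟨Q, hQ⟩ := this
    rw [hQ, mul_assoc, coeff_X_pow_mul', if_neg (by omega)]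
  have hmain : d⁄dX ℂ (U ^ (12 * k + 6)) * (u ^ 4 * V ^ 2) ^ (2 * k + 2) =
      C (-((12 * k + 6 : ℕ) : ℂ)) * (u * E ^ (4 * k) * (u * E) ^ 4) := by
    rw [derivative_pow, hdU, show 12 * k + 6 - 1 = 12 * k + 5 by omega, map_neg, map_natCast,
      ← hV, ← hUV]
    have := huUp (8 * k + 7)
    linear_combination (-((12 * k + 6 : ℕ) : ℂ⟦X⟧)) * u * (U * V) ^ (4 * k) * V ^ 4 * this
  simp only [map_add, add_mul] at hd
  rw [hzero, htail, hmain, add_zero, coeff_C_mul, eq_comm, mul_eq_zero] at hd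
  rcases hd with hd | hd
  · rw [neg_eq_zero, Nat.cast_eq_zero] at hd
    omega
  · rw [hu, hE] at hd
    exact coeff_evenGeometric_product_ne_zero ℂ (4 * k) (2 * k + 1) hd

/-! ### Gleason's theorem for the dihedral group of order 16 -/

section Gleason

open Polynomial

theorem finite_octahedron_vertices : {y : ℂ | ¬ y * (1 - y ^ 4) ≠ 0}.Finite := by
  have hne : (X * (1 - X ^ 4) : ℂ[X]) ≠ 0 := by
    intro h
    have := congrArg (eval 2) h
    norm_num at this
  refine (finite_setOfPred_isRoot hne).subset fun y hy => ?_
  simpa [IsRoot, or_iff_not_imp_left] using hy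

theorem Polynomial.eq_of_eval_eq_off_vertices {p q : ℂ[X]}
    (h : ∀ y, y * (1 - y ^ 4) ≠ 0 → p.eval y = q.eval y) : p = q := by
  refine eq_of_infinite_eval_eq p q ?_
  refine (finite_octahedron_vertices.infinite_compl).mono fun y hy => h y ?_
  simpa using hy

theorem vertex_factors {y : ℂ} (h : y * (1 - y ^ 4) ≠ 0) :
    y ≠ 0 ∧ 1 - y ≠ 0 ∧ 1 + y ≠ 0 ∧ 1 + y ^ 2 ≠ 0 := by
  refine ⟨?_, ?_, ?_, ?_⟩ <;> intro h0 <;> apply h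
  · rw [h0, zero_mul]
  · linear_combination y * (1 + y) * (1 + y ^ 2) * h0
  · linear_combination y * (1 - y) * (1 + y ^ 2) * h0
  · linear_combination y * (1 - y) * (1 + y) * h0

/-- `T` is the dehomogenization of a form of degree `8 * q` invariant under the dihedral group
of order `16`; the identities are required off the vertices of the octahedron only. -/
structure IsDihedralInvariant (q : ℕ) (T : ℂ[X]) : Prop where
  natDegree_le : T.natDegree ≤ 8 * q
  eval_neg : ∀ y, y * (1 - y ^ 4) ≠ 0 → T.eval (-y) = T.eval y
  eval_inv : ∀ y, y * (1 - y ^ 4) ≠ 0 → T.eval y⁻¹ * y ^ (8 * q) = T.eval y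
  eval_cayley : ∀ y, y * (1 - y ^ 4) ≠ 0 →
    (1 + y) ^ (8 * q) * T.eval ((1 - y) / (1 + y)) = 2 ^ (4 * q) * T.eval y

namespace IsDihedralInvariant

variable {q : ℕ} {T : ℂ[X]}

theorem comp_neg_X (hT : IsDihedralInvariant q T) : T.comp (-X) = T :=
  eq_of_eval_eq_off_vertices fun y hy => by simpa using hT.eval_neg y hy

theorem coeff_eq_zero (hT : IsDihedralInvariant q T) {i : ℕ} (hi : Odd i) : T.coeff i = 0 := by
  have h' : T.comp (C (-1) * X) = T := by simpa using hT.comp_neg_X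
  have h := congrArg (fun p => coeff p i) h'
  simp only [comp_C_mul_X_coeff, hi.neg_one_pow] at h
  linear_combination (-1 / 2) * h

theorem coeff_top (hT : IsDihedralInvariant q T) : T.coeff (8 * q) = T.coeff 0 := by
  have h : reflect (8 * q) T = T := by
    refine eq_of_eval_eq_off_vertices fun y hy => ?_
    have hy0 := (vertex_factors hy).1
    let : Invertible y⁻¹ := invertibleOfNonzero (inv_ne_zero hy0)
    have h1 := eval₂_reflect_mul_pow (RingHom.id ℂ) y⁻¹ (8 * q) T hT.natDegree_le
    simp only [invOf_eq_inv, inv_inv] at h1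
    change eval y _ * _ = eval y⁻¹ T at h1
    rw [← hT.eval_inv y hy, ← h1, mul_assoc, ← mul_pow, inv_mul_cancel₀ hy0, one_pow, mul_one]
  have := congrArg (fun p => coeff p 0) h
  simpa [coeff_reflect] using this

theorem X_sq_dvd (hT : IsDihedralInvariant q T) (h0 : T.coeff 0 = 0) : (X : ℂ[X]) ^ 2 ∣ T := by
  rw [X_pow_dvd_iff]
  intro d hd
  interval_cases d
  · exact h0
  · exact hT.coeff_eq_zero odd_one

/-- The map `y ↦ (1-y)/(1+y)` sends 1 to 0, so the double zero at 0 is transported to 1. -/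
theorem one_sub_X_sq_dvd (hT : IsDihedralInvariant (q + 1) T) (h0 : T.coeff 0 = 0) :
    (1 - X : ℂ[X]) ^ 2 ∣ T := by
  obtain ⟨h, rfl⟩ := hT.X_sq_dvd h0
  rcases eq_or_ne h 0 with rfl | hne
  · simp
  have hdeg : h.natDegree ≤ 8 * q + 6 := by
    have := hT.natDegree_le
    rw [natDegree_mul (pow_ne_zero _ X_ne_zero) hne, natDegree_X_pow] at this
    omega
  -- `r` is the form of degree `8q+6` attached to `h`, evaluated at `(1 + X, 1 - X)`; it clears the
  -- denominators of the Cayley transform.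
  let r : ℂ[X] := ∑ i ∈ Finset.range (8 * q + 7),
    C (h.coeff i) * ((1 - X) ^ i * (1 + X) ^ (8 * q + 6 - i))
  have hr : C (2 ^ (4 * (q + 1))) * (X ^ 2 * h) = (1 - X) ^ 2 * r := by
    refine eq_of_eval_eq_off_vertices fun y hy => ?_
    obtain ⟨_, _, h1, _⟩ := vertex_factors hy
    have key := hT.eval_cayley y hy
    have hre : r.eval y = (1 + y) ^ (8 * q + 6) * h.eval ((1 - y) / (1 + y)) := by
      rw [eval_eq_sum_range' (Nat.lt_succ_of_le hdeg), Finset.mul_sum]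
      simp only [r, eval_finsetSum]
      refine Finset.sum_congr rfl fun i hi => ?_
      rw [Finset.mem_range] at hi
      have e : (1 + y) ^ (8 * q + 6) = (1 + y) ^ (8 * q + 6 - i) * (1 + y) ^ i := by
        rw [← pow_add]; congr 1; omega
      rw [e]
      simp only [eval_mul, eval_C, eval_pow, eval_sub, eval_add, eval_one, eval_X, div_pow]
      field_simp
    rw [eval_mul, eval_C, ← key, eval_mul (p := (1 - X) ^ 2), hre]
    simp only [eval_mul, eval_pow, eval_sub, eval_one, eval_X]
    rw [show 8 * (q + 1) = 8 * q + 6 + 2 by ring, pow_add]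
    field_simp
  have : (1 - X : ℂ[X]) ^ 2 ∣ C (2 ^ (4 * (q + 1))) * (X ^ 2 * h) := ⟨r, hr⟩
  exact (IsUnit.dvd_mul_left (isUnit_C.2 (pow_ne_zero _ two_ne_zero).isUnit)).1 this

/-- The double zero at 0 spreads to 1, -1 and ∞, the orbit of 0. The form of degree 8 with exactly
these zeros dehomogenizes to `X²(1-X²)²`, of degree 6 only. -/
theorem exists_eq_mul (hT : IsDihedralInvariant (q + 1) T) (h0 : T.coeff 0 = 0) :
    ∃ g, IsDihedralInvariant q g ∧ T = X ^ 2 * (1 - X ^ 2) ^ 2 * g := by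
  have h1 := hT.X_sq_dvd h0
  have h2 := hT.one_sub_X_sq_dvd h0
  have h3 : (1 + X : ℂ[X]) ^ 2 ∣ T := by
    have := map_dvd (compRingHom (-X : ℂ[X])) h2
    simpa [hT.comp_neg_X] using this
  have h4 : (1 - X ^ 2 : ℂ[X]) ^ 2 ∣ T := by
    have := ((BinaryCode.isCoprime_one_sub_one_add X).pow (m := 2) (n := 2)).mul_dvd h2 h3
    rw [← mul_pow] at this
    convert this using 2
    ring
  have hcop : IsCoprime (X : ℂ[X]) (1 - X ^ 2) := ⟨X, 1, by ring⟩
  obtain ⟨g, hg⟩ := (hcop.pow (m := 2) (n := 2)).mul_dvd h1 h4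
  refine ⟨g, ?_, hg⟩
  have heval : ∀ y, T.eval y = y ^ 2 * (1 - y ^ 2) ^ 2 * g.eval y := fun y => by
    rw [hg]; simp
  have hsq : ∀ {y : ℂ}, y * (1 - y ^ 4) ≠ 0 → y ^ 2 * (1 - y ^ 2) ^ 2 ≠ 0 := fun {y} hy => by
    obtain ⟨a, b, c, _⟩ := vertex_factors hy
    rw [show y ^ 2 * (1 - y ^ 2) ^ 2 = y ^ 2 * ((1 - y) ^ 2 * (1 + y) ^ 2) by ring]
    positivity
  refine ⟨?_, ?_, ?_, ?_⟩
  · rcases eq_or_ne g 0 with rfl | hne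
    · simp
    have hp : (X ^ 2 * (1 - X ^ 2) ^ 2 : ℂ[X]).natDegree = 6 := by
      have : (X ^ 2 * (1 - X ^ 2) ^ 2 : ℂ[X]) = C 1 * X ^ 6 + C (-2) * X ^ 4 + C 1 * X ^ 2 := by
        simp only [map_neg, map_ofNat, map_one]
        ring
      rw [this]
      compute_degree!
    have hp0 : (X ^ 2 * (1 - X ^ 2) ^ 2 : ℂ[X]) ≠ 0 := fun h => by simp [h] at hp
    -- The double zero at ∞: the top coefficient equals the constant one, which is zero, and the
    -- next has odd index.
    have hdeg : T.natDegree ≤ 8 * q + 6 := by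
      rw [natDegree_le_iff_coeff_eq_zero]
      intro N hN
      rcases lt_or_ge (8 * (q + 1)) N with h | h
      · exact coeff_eq_zero_of_natDegree_lt (hT.natDegree_le.trans_lt h)
      · obtain rfl | rfl : N = 8 * (q + 1) ∨ N = 8 * q + 7 := by omega
        · rw [hT.coeff_top, h0]
        · exact hT.coeff_eq_zero ⟨4 * q + 3, by ring⟩
    rw [hg, natDegree_mul hp0 hne, hp] at hdeg
    omega
  · intro y hy
    have := hT.eval_neg y hy
    rw [heval, heval, neg_sq] at this
    exact mul_left_cancel₀ (hsq hy) this
  · intro y hy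
    have hy0 := (vertex_factors hy).1
    have := hT.eval_inv y hy
    rw [heval, heval] at this
    refine mul_left_cancel₀ (hsq hy) (Eq.trans ?_ this)
    rw [show 8 * (q + 1) = 8 * q + 8 by ring, pow_add]
    field_simp
    ring
  · intro y hy
    obtain ⟨a, b, c, _⟩ := vertex_factors hy
    have := hT.eval_cayley y hy
    rw [heval, heval] at this
    refine mul_left_cancel₀ (mul_ne_zero (pow_ne_zero 4 two_ne_zero) (hsq hy)) ?_
    have e : (2 : ℂ) ^ (4 * (q + 1)) = 2 ^ 4 * 2 ^ (4 * q) := by ring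
    rw [e] at this
    refine Eq.trans ?_ (this.trans (by ring))
    rw [show 8 * (q + 1) = 8 * q + 8 by ring, pow_add]
    generalize eval ((1 - y) / (1 + y)) g = z
    field_simp
    ring

/-- The pair ±i is preserved by the group, so `(1+X²)^(4q)` is itself invariant; for the Cayley map
this is `(1+y)² + (1-y)² = 2(1+y²)`. -/
theorem sub_C_mul (hT : IsDihedralInvariant q T) (c : ℂ) :
    IsDihedralInvariant q (T - C c * (1 + X ^ 2) ^ (4 * q)) := by
  have hev : ∀ y, (T - C c * (1 + X ^ 2) ^ (4 * q)).eval y =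
      T.eval y - c * (1 + y ^ 2) ^ (4 * q) := fun y => by simp
  refine ⟨?_, ?_, ?_, ?_⟩
  · refine (natDegree_sub_le _ _).trans (max_le hT.natDegree_le ?_)
    refine (natDegree_C_mul_le _ _).trans (natDegree_pow_le.trans ?_)
    have : (1 + X ^ 2 : ℂ[X]).natDegree ≤ 2 := by compute_degree
    calc 4 * q * _ ≤ 4 * q * 2 := Nat.mul_le_mul_left _ this
      _ = 8 * q := by ring
  · intro y hy
    rw [hev, hev, hT.eval_neg y hy, neg_sq]
  · intro y hy
    have hy0 := (vertex_factors hy).1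
    rw [hev, hev, sub_mul, hT.eval_inv y hy, show 8 * q = 2 * (4 * q) by ring, pow_mul y,
      mul_assoc, ← mul_pow]
    congr 3
    field_simp
    ring
  · intro y hy
    obtain ⟨a, b, h1, _⟩ := vertex_factors hy
    rw [hev, hev, mul_sub, hT.eval_cayley y hy, mul_sub, show 8 * q = 2 * (4 * q) by ring,
      pow_mul (1 + y), mul_left_comm, ← mul_pow, mul_left_comm, ← mul_pow]
    congr 3
    field_simp
    ring

/-- Subtracting the multiple of `(1+X²)^(4q)` with the same constant term leaves an invariant
divisible by `X²(1-X²)²`, and induction applies to the quotient. Both generators are even, hence the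
`expand` by 2. -/
theorem exists_eq_expand : ∀ {q : ℕ} {T : ℂ[X]}, IsDihedralInvariant q T →
    ∃ a : ℕ → ℂ, T = expand ℂ 2 (∑ j ∈ Finset.range (q + 1),
      C (a j) * ((1 + X) ^ (4 * (q - j)) * (X * (1 - X) ^ 2) ^ j)) := by
  intro q
  induction q with
  | zero =>
    intro T hT
    refine ⟨fun _ => T.coeff 0, ?_⟩
    have := eq_C_of_natDegree_le_zero hT.natDegree_le
    simpa using this
  | succ q ih =>
    intro T hT
    have hT' := hT.sub_C_mul (T.coeff 0)
    obtain ⟨g, hg, hTg⟩ := hT'.exists_eq_mul (by simp [coeff_zero_eq_eval_zero])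
    obtain ⟨a, ha⟩ := ih hg
    refine ⟨fun j => Nat.casesOn j (T.coeff 0) a, ?_⟩
    rw [sub_eq_iff_eq_add] at hTg
    rw [Finset.sum_range_succ', map_add]
    conv_lhs => rw [hTg, ha]
    congr 1
    · rw [map_sum, map_sum, Finset.mul_sum]
      refine Finset.sum_congr rfl fun j _ => ?_
      simp only [map_mul, map_pow, map_add, map_sub, map_one, expand_X, expand_C,
        Nat.add_sub_add_right]
      ring
    · simp

end IsDihedralInvariant

end Gleason

/-! ### Weight enumerators of self-dual codes and the bound at length `24k+12` -/

namespace BinaryCode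

open Polynomial

variable {n : ℕ}

theorem weightForm_neg {R : Type*} [CommRing R] [Algebra ℂ R] {φ : BinaryVector n → ℂ}
    (h : ∀ u, φ u ≠ 0 → hammingNorm u % 2 = 0) (x y : R) :
    weightForm φ x (-y) = weightForm φ x y := by
  refine Finset.sum_congr rfl fun u _ => ?_
  by_cases hu : φ u = 0
  · simp [hu]
  · rw [Even.neg_pow (Nat.even_iff.2 (h u hu))]

theorem cosetChar_zero_eq (C : BinaryCode n) (u : BinaryVector n) :
    (u ∈ C → cosetChar C 0 0 u = 1) ∧ (u ∉ C → cosetChar C 0 0 u = 0) := by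
  rw [cosetChar, zero_add]
  exact ⟨fun h => by simp [h], fun h => by simp [h]⟩

theorem IsSelfDual.even_of_cosetChar_ne_zero {C : BinaryCode n} (h : IsSelfDual C)
    (u : BinaryVector n) (hu : cosetChar C 0 0 u ≠ 0) : hammingNorm u % 2 = 0 := by
  by_contra hne
  exact hu ((cosetChar_zero_eq C u).2 fun hC => hne (h.hammingNorm_mod_two hC))

theorem IsSelfDual.weightForm_code {R : Type*} [CommRing R] [Algebra ℂ R] {C : BinaryCode n}
    (h : IsSelfDual C) (x y : R) :
    weightForm (cosetChar C 0 0) (x + y) (x - y) =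
      (2 : ℂ) ^ Module.finrank (ZMod 2) C • weightForm (cosetChar C 0 0) x y := by
  rw [weightForm_add_sub, ← weightForm_const_mul]
  congr 1
  funext u
  rw [h.fourierTransform_cosetChar, cosetChar]
  simp

theorem IsSelfDual.weightForm_code_comm {C : BinaryCode n} (h : IsSelfDual C) (x y : ℂ) :
    weightForm (cosetChar C 0 0) x y = weightForm (cosetChar C 0 0) y x := by
  have h1 := h.weightForm_code x y
  have h2 := h.weightForm_code y x
  rw [← neg_sub x y, weightForm_neg h.even_of_cosetChar_ne_zero, add_comm y x, h1] at h2
  exact smul_right_injective ℂ (pow_ne_zero _ two_ne_zero) h2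

theorem natDegree_weightForm_le (φ : BinaryVector n → ℂ) :
    (weightForm φ (1 : ℂ[X]) X).natDegree ≤ n := by
  refine natDegree_sum_le_of_forall_le _ _ fun u _ => ?_
  refine (natDegree_smul_le _ _).trans ?_
  rw [one_pow, one_mul, natDegree_X_pow]
  simpa using hammingNorm_le_card_fintype (x := u)

theorem eval_weightForm (φ : BinaryVector n → ℂ) (y : ℂ) :
    (weightForm φ (1 : ℂ[X]) X).eval y = weightForm φ 1 y := by
  have := aeval_weightForm φ 1 X y
  rwa [map_one, aeval_X, coe_aeval_eq_eval] at this

/-- The shadow enumerator vanishes to order `s` at `y = 0`. The shadow identity moves this zero of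
the form to a zero of the code enumerator at `i`, and evenness gives -i as well. -/
theorem one_add_X_sq_pow_dvd_weightForm {D : BinaryCode n} (hD : IsSinglyEvenSelfDual D) {s : ℕ}
    (hs : ∀ u ∈ shadow D, s ≤ hammingNorm u) :
    (1 + X ^ 2 : ℂ[X]) ^ s ∣ weightForm (cosetChar D 0 0) (1 : ℂ[X]) X := by
  obtain ⟨v, hv⟩ := hD.1.exists_isHalfWeightVector
  set W := weightForm (cosetChar D 0 0) (1 : ℂ[X]) X with hW
  have h1 : (1 - X : ℂ[X]) ^ s ∣ aeval (C Complex.I * X : ℂ[X]) W := by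
    rw [hW, aeval_weightForm, map_one, aeval_X, ← smul_eq_C_mul]
    refine dvd_of_dvd_smul (κ := 2 ^ Module.finrank (ZMod 2) D) (pow_ne_zero _ two_ne_zero) ?_
    rw [← weightForm_cosetChar_shadow hD.1 hv]
    refine pow_dvd_weightForm (fun u hu => hs u ?_) _ _
    rw [mem_shadow_iff hD ((isHalfWeightVector_iff_mem_shadow hD).1 hv)]
    by_contra h
    exact hu (if_neg h)
  have h2 : (1 + C Complex.I * X : ℂ[X]) ^ s ∣ W := by
    have := map_dvd (aeval (C (-Complex.I) * X : ℂ[X])) h1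
    have e : aeval (C (-Complex.I) * X : ℂ[X]) (aeval (C Complex.I * X : ℂ[X]) W) = W := by
      rw [hW, aeval_weightForm, aeval_weightForm]
      congr 1
      · simp
      · simp [← mul_assoc, ← C_mul]
    rw [e] at this
    simpa using this
  have hneg : aeval (C (-1) * X : ℂ[X]) W = (1 : ℂ) • W :=
    aeval_C_mul_X_weightForm fun u hu =>
      Even.neg_one_pow (Nat.even_iff.2 (hD.1.even_of_cosetChar_ne_zero u hu))
  have h3 : (1 - C Complex.I * X : ℂ[X]) ^ s ∣ W :=
    dvd_of_aeval_C_mul_X one_ne_zero hneg (by simp [sub_eq_add_neg]) h2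
  have h4 := ((isCoprime_one_sub_one_add (C Complex.I * X)).pow (m := s) (n := s)).mul_dvd h3 h2
  rw [← mul_pow] at h4
  convert h4 using 2
  have : (C Complex.I : ℂ[X]) * C Complex.I = -1 := by rw [← C_mul]; simp
  linear_combination X ^ 2 * this

/-- The enumerator satisfies the three transformation laws in degree `n`, and `(1+y²)^s` satisfies
them in degree `2 * s`; away from ±i it can be cancelled. -/
theorem isDihedralInvariant_of_weightForm_eq {C : BinaryCode n} (h : IsSelfDual C)
    {s q : ℕ} (hn : n = 2 * s + 8 * q) (hf : Module.finrank (ZMod 2) C = s + 4 * q) {T : ℂ[X]}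
    (hT : weightForm (cosetChar C 0 0) (1 : ℂ[X]) X = (1 + X ^ 2) ^ s * T) :
    IsDihedralInvariant q T := by
  have hev : ∀ y, weightForm (cosetChar C 0 0) 1 y = (1 + y ^ 2) ^ s * T.eval y := fun y => by
    rw [← eval_weightForm, hT]
    simp
  refine ⟨?_, ?_, ?_, ?_⟩
  · rcases eq_or_ne T 0 with rfl | hne
    · simp
    have h1 := natDegree_weightForm_le (cosetChar C 0 0)
    have h2 : (1 + X ^ 2 : ℂ[X]).natDegree = 2 := by
      rw [add_comm]
      exact natDegree_X_pow_add_C (r := 1)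
    have h3 : (1 + X ^ 2 : ℂ[X]) ≠ 0 := fun h => by simp [h] at h2
    rw [hT, natDegree_mul (pow_ne_zero _ h3) hne, natDegree_pow, h2] at h1
    omega
  · intro y hy
    obtain ⟨_, _, _, h1⟩ := vertex_factors hy
    have := weightForm_neg h.even_of_cosetChar_ne_zero 1 y
    rw [hev, hev, neg_sq] at this
    exact mul_left_cancel₀ (pow_ne_zero _ h1) this
  · intro y hy
    obtain ⟨hy0, _, _, h1⟩ := vertex_factors hy
    have := weightForm_mul (cosetChar C 0 0) y 1 y⁻¹
    rw [mul_one, mul_inv_cancel₀ hy0, h.weightForm_code_comm, hev, hev, hn, pow_add,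
      pow_mul] at this
    refine mul_left_cancel₀ (pow_ne_zero s h1) (this.trans ?_).symm
    have e : (1 + y ^ 2) ^ s = (y ^ 2) ^ s * (1 + y⁻¹ ^ 2) ^ s := by
      rw [← mul_pow]
      congr 1
      field_simp
      ring
    rw [e]
    ring
  · intro y hy
    obtain ⟨hy0, _, hy1, h1⟩ := vertex_factors hy
    have hpow : (1 + y) ^ n = (1 + y) ^ (2 * s) * (1 + y) ^ (8 * q) := by rw [← pow_add, ← hn]
    have := weightForm_mul (cosetChar C 0 0) (1 + y) 1 ((1 - y) / (1 + y))
    rw [mul_one, mul_div_cancel₀ _ hy1, h.weightForm_code, hev, hev, hf, smul_eq_mul, hpow,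
      pow_add 2, pow_mul _ 2 s] at this
    have e : ((1 + y) ^ 2) ^ s * (1 + ((1 - y) / (1 + y)) ^ 2) ^ s = 2 ^ s * (1 + y ^ 2) ^ s := by
      rw [← mul_pow, ← mul_pow]
      congr 1
      field_simp
      ring
    have h2 : (2 : ℂ) ^ s * (1 + y ^ 2) ^ s ≠ 0 :=
      mul_ne_zero (pow_ne_zero _ two_ne_zero) (pow_ne_zero _ h1)
    refine mul_left_cancel₀ h2 ?_
    linear_combination -(1 + y) ^ (8 * q) * eval ((1 - y) / (1 + y)) T * e - this

/-- A self-dual code of length `24 * k + 12` whose shadow has no vector of weight less than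
`4 * k + 2` has minimum weight less than `4 * k + 6`. -/
theorem exists_hammingNorm_lt {k : ℕ} {D : BinaryCode (24 * k + 12)}
    (hD : IsSinglyEvenSelfDual D) (hf : Module.finrank (ZMod 2) D = 12 * k + 6)
    (hs : ∀ u ∈ shadow D, 4 * k + 2 ≤ hammingNorm u) :
    ∃ x ∈ D, x ≠ 0 ∧ hammingNorm x < 4 * k + 6 := by
  by_contra! hmin
  obtain ⟨T, hT⟩ := one_add_X_sq_pow_dvd_weightForm hD hs
  have hinv : IsDihedralInvariant (2 * k + 1) T :=
    isDihedralInvariant_of_weightForm_eq hD.1 (by ring) (hf.trans (by ring)) hT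
  obtain ⟨a, rfl⟩ := hinv.exists_eq_expand
  set p : ℂ[X] := (1 + X) ^ (4 * k + 2) * ∑ j ∈ Finset.range (2 * k + 1 + 1),
    C (a j) * ((1 + X) ^ (4 * (2 * k + 1 - j)) * (X * (1 - X) ^ 2) ^ j) with hp
  have hWp : weightForm (cosetChar D 0 0) (1 : ℂ[X]) X = expand ℂ 2 p := by
    rw [hT, hp, map_mul]
    simp
  -- In the variable `X²` the index `d ≤ 2k+2` stands for weight `2d ≤ 4k+4`, below the supposed
  -- minimum `4k+6`.
  have hdvd : X ^ (2 * k + 3) ∣ p - 1 := by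
    rw [X_pow_dvd_iff]
    intro d hd
    have h1 : p.coeff d = (expand ℂ 2 p).coeff (d * 2) := (coeff_expand_mul two_pos p d).symm
    rw [coeff_sub, h1, ← hWp, coeff_weightForm, coeff_one, sub_eq_zero]
    rw [Finset.sum_eq_single (0 : BinaryVector (24 * k + 12))]
    · rw [(cosetChar_zero_eq D 0).1 D.zero_mem, hammingNorm_zero]
      congr 1
      simp only [eq_iff_iff]
      omega
    · intro u _ hu
      split_ifs with hw
      · refine (cosetChar_zero_eq D u).2 fun huD => ?_
        have := hmin u huD hu
        omega
      · rfl
    · simp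
  obtain ⟨R, hR⟩ := hdvd
  rw [sub_eq_iff_eq_add'] at hR
  refine octahedral_expansion_ne k a (R : PowerSeries ℂ) ?_
  have := congrArg (coeToPowerSeries.ringHom (R := ℂ)) hR
  rw [hp, map_mul, map_sum] at this
  simpa using this

/-! ### Minimum weights of the neighbors in the three cases -/

theorem HasMinWeight.le {D : Set (BinaryVector n)} {d : ℕ} (h : HasMinWeight D d)
    {x : BinaryVector n} (hx : x ∈ D) (h0 : hammingNorm x ≠ 0) : d ≤ hammingNorm x :=
  h.2 ⟨h0, x, hx, rfl⟩

theorem hasMinWeight_of {D : Set (BinaryVector n)} {d : ℕ} (hd : d ≠ 0)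
    (h : ∃ x ∈ D, hammingNorm x = d)
    (hle : ∀ x ∈ D, hammingNorm x ≠ 0 → d ≤ hammingNorm x) : HasMinWeight D d := by
  refine ⟨⟨hd, h⟩, ?_⟩
  rintro w ⟨hw, x, hx, rfl⟩
  exact hle x hx hw

theorem IsSExtremal.hasMinWeight_shadow {C : BinaryCode n} (h : IsSExtremal C) {d : ℕ}
    (hd : HasMinWeight (C : Set (BinaryVector n)) d) (hn : n % 24 ≠ 22) :
    ∃ s, HasMinWeight (shadow C) s ∧ s + 2 * d = n / 2 + 4 := by
  obtain ⟨_, d', s, hd', hs, he⟩ := h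
  obtain rfl := hd.unique hd'
  rw [if_neg fun h => hn h.1] at he
  exact ⟨s, hs, he⟩

theorem shadow_hammingNorm_mod_four {C : BinaryCode n} (hC : IsSinglyEvenSelfDual C)
    (hn : n = 2 * Module.finrank (ZMod 2) C) (hm : Module.finrank (ZMod 2) C % 4 = 2)
    {u : BinaryVector n} (hu : u ∈ shadow C) : hammingNorm u % 4 = 2 := by
  rw [((isHalfWeightVector_iff_mem_shadow hC).2 hu).hammingNorm_mod_four hC.1 hn, hm]

/-- In any labelling `C₁` and `C₃` are both of the form `v + C₀` with `v` in the shadow, so it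
suffices to treat every shadow vector uniformly. -/
theorem shadowNeighborsSatisfy_of {C : BinaryCode n} (hC : IsSinglyEvenSelfDual C)
    (hn : n = 2 * Module.finrank (ZMod 2) C) (hm : Module.finrank (ZMod 2) C % 4 = 2)
    {P : BinaryCode n → Prop} (hP : ∀ v ∈ shadow C, P (shadowNeighbor C hC.1 v)) :
    ShadowNeighborsSatisfy C P := by
  refine ⟨hC.exists_isCosetDecomposition, fun C₁ C₂ C₃ h => ?_⟩
  obtain ⟨v, hv, h1⟩ := h.exists_eq
  obtain ⟨w, hw, h3⟩ := h.swap.exists_eq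
  have hmod := fun u hu => shadow_hammingNorm_mod_four hC hn hm (u := u) hu
  have hfr : Module.finrank (ZMod 2) C = n / 2 := by omega
  exact ⟨shadowNeighbor C hC.1 v, shadowNeighbor C hC.1 w, by rw [h1]; rfl, by rw [h3]; rfl,
    isNeighbor_shadowNeighbor hC hv (hmod v hv) hfr,
    isNeighbor_shadowNeighbor hC hw (hmod w hw) hfr, hP v hv, hP w hw⟩

theorem exists_hammingNorm_eq_of_hasMinWeight {C : BinaryCode n} (hC : IsSinglyEvenSelfDual C)
    {v : BinaryVector n} (hv : v ∈ shadow C)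
    (h4 : ∀ u ∈ shadow C, hammingNorm u % 4 = 2) {s : ℕ} (hs : HasMinWeight (shadow C) s)
    (hn : n < 6 * s) :
    (∃ u ∈ shadow C, v + u ∈ doublyEvenPart C ∧ hammingNorm u = s) ∧
      ∃ u ∈ shadow C, v + u ∉ doublyEvenPart C ∧ hammingNorm u = s := by
  have hle : ∀ u ∈ shadow C, s ≤ hammingNorm u := fun u hu => hs.le hu (by
    have := h4 u hu
    omega)
  have hiff := exists_hammingNorm_eq_iff hC hv h4 hle hn s
  obtain ⟨_, u, hu, hus⟩ := hs.1
  by_cases h : v + u ∈ doublyEvenPart C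
  · exact ⟨⟨u, hu, h, hus⟩, hiff.1 ⟨u, hu, h, hus⟩⟩
  · exact ⟨hiff.2 ⟨u, hu, h, hus⟩, u, hu, h, hus⟩

section MinWeight

variable {C : BinaryCode n} {v : BinaryVector n} {d : ℕ}

theorem hasMinWeight_shadowNeighbor (hC : IsSinglyEvenSelfDual C) (hv : v ∈ shadow C) (hd : d ≠ 0)
    (h : ∃ x ∈ shadowNeighbor C hC.1 v, hammingNorm x = d)
    (h0 : ∀ x ∈ doublyEvenPart C, hammingNorm x ≠ 0 → d ≤ hammingNorm x)
    (h1 : ∀ x ∈ shadow C, d ≤ hammingNorm x) :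
    HasMinWeight (shadowNeighbor C hC.1 v : Set (BinaryVector n)) d := by
  refine hasMinWeight_of hd h fun x hx hx0 => ?_
  rcases mem_shadowNeighbor.1 hx with hx | hx
  · exact h0 x hx hx0
  · exact h1 x ((mem_shadow_iff hC hv).2 hx.1)

theorem hasMinWeight_shadow_shadowNeighbor (hC : IsSinglyEvenSelfDual C) (hv : v ∈ shadow C)
    (hv' : hammingNorm v % 4 = 2) (hd : d ≠ 0)
    (h : ∃ x, ((x ∈ C ∧ hammingNorm x % 4 = 2) ∨ (x ∈ shadow C ∧ v + x ∉ doublyEvenPart C)) ∧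
      hammingNorm x = d)
    (h0 : ∀ x ∈ C, hammingNorm x % 4 = 2 → d ≤ hammingNorm x)
    (h1 : ∀ x ∈ shadow C, d ≤ hammingNorm x) :
    HasMinWeight (shadow (shadowNeighbor C hC.1 v)) d := by
  have hmod : ∀ x ∈ C, x ∉ doublyEvenPart C ↔ hammingNorm x % 4 = 2 := fun x hx => by
    have := hC.1.hammingNorm_mod_two hx
    simp only [mem_doublyEvenPart, hx, true_and]
    omega
  refine hasMinWeight_of hd ?_ fun x hx _ => ?_
  · obtain ⟨x, hx, hxd⟩ := h
    refine ⟨x, (mem_shadow_shadowNeighbor hC hv hv').2 ?_, hxd⟩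
    exact hx.imp (fun hx => ⟨hx.1, (hmod x hx.1).2 hx.2⟩) id
  · rcases (mem_shadow_shadowNeighbor hC hv hv').1 hx with hx | hx
    · exact h0 x hx.1 ((hmod x hx.1).1 hx.2)
    · exact h1 x hx.1

end MinWeight

theorem shadowNeighborsSatisfy_length_four_mod {k : ℕ} {C : BinaryCode (24 * k + 4)}
    (hC : IsSExtremal C) (hp : HasParameters C (12 * k + 2) (4 * k + 2)) :
    ShadowNeighborsSatisfy C fun N =>
      IsSExtremal N ∧ HasParameters N (12 * k + 2) (4 * k + 2) := by
  obtain ⟨hf, hd⟩ := hp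
  obtain ⟨s, hs, hsd⟩ := hC.hasMinWeight_shadow hd (by omega)
  obtain rfl : s = 4 * k + 2 := by omega
  replace hC := hC.1
  have hn : 24 * k + 4 = 2 * Module.finrank (ZMod 2) C := by omega
  have hm : Module.finrank (ZMod 2) C % 4 = 2 := by omega
  refine shadowNeighborsSatisfy_of hC hn hm fun v hv => ?_
  have hmod := fun u hu => shadow_hammingNorm_mod_four hC hn hm (u := u) hu
  obtain ⟨⟨u, hu, hvu, hus⟩, _⟩ :=
    exists_hammingNorm_eq_of_hasMinWeight hC hv hmod hs (by omega)
  have hle : ∀ x ∈ shadow C, 4 * k + 2 ≤ hammingNorm x := fun x hx => hs.le hx (by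
    have := hmod x hx
    omega)
  have hN : HasMinWeight (shadowNeighbor C hC.1 v : Set (BinaryVector (24 * k + 4))) (4 * k + 2) :=
    hasMinWeight_shadowNeighbor hC hv (by omega) ⟨u, mem_shadowNeighbor.2 (Or.inr hvu), hus⟩
      (fun x hx hx0 => hd.le hx.1 hx0) hle
  refine ⟨⟨isSinglyEvenSelfDual_shadowNeighbor hC hv (hmod v hv), 4 * k + 2, 4 * k + 2, hN, ?_, ?_⟩,
    (finrank_shadowNeighbor hC hv).trans hf, hN⟩
  -- A minimum weight word of `C` has weight 2 modulo 4, so it lies in `C₂`, which is part of the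
  -- new shadow.
  · obtain ⟨_, c, hc, hcd⟩ := hd.1
    exact hasMinWeight_shadow_shadowNeighbor hC hv (hmod v hv) (by omega)
      ⟨c, Or.inl ⟨hc, by omega⟩, hcd⟩ (fun x hx hx2 => hd.le hx (by omega)) hle
  · rw [if_neg (by omega)]
    omega

theorem shadowNeighborsSatisfy_length_twenty_mod {k : ℕ} {C : BinaryCode (24 * k + 20)}
    (hC : IsSExtremal C) (hp : HasParameters C (12 * k + 10) (4 * k + 4)) :
    ShadowNeighborsSatisfy C fun N =>
      IsSExtremal N ∧ IsExtremal N ∧ HasParameters N (12 * k + 10) (4 * k + 4) := by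
  obtain ⟨hf, hd⟩ := hp
  obtain ⟨s, hs, hsd⟩ := hC.hasMinWeight_shadow hd (by omega)
  obtain rfl : s = 4 * k + 6 := by omega
  replace hC := hC.1
  have hn : 24 * k + 20 = 2 * Module.finrank (ZMod 2) C := by omega
  have hm : Module.finrank (ZMod 2) C % 4 = 2 := by omega
  refine shadowNeighborsSatisfy_of hC hn hm fun v hv => ?_
  have hmod := fun u hu => shadow_hammingNorm_mod_four hC hn hm (u := u) hu
  obtain ⟨_, u, hu, hvu, hus⟩ :=
    exists_hammingNorm_eq_of_hasMinWeight hC hv hmod hs (by omega)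
  have hle : ∀ x ∈ shadow C, 4 * k + 6 ≤ hammingNorm x := fun x hx => hs.le hx (by
    have := hmod x hx
    omega)
  have hN : HasMinWeight (shadowNeighbor C hC.1 v : Set (BinaryVector (24 * k + 20)))
      (4 * k + 4) := by
    -- Here the minimum weight of `C` is divisible by 4, so it is attained in `C₀` and survives in
    -- the neighbor. The equality of the two halves is needed for the new shadow instead.
    obtain ⟨_, c, hc, hcd⟩ := hd.1
    exact hasMinWeight_shadowNeighbor hC hv (by omega)
      ⟨c, mem_shadowNeighbor.2 (Or.inl ⟨hc, by omega⟩), hcd⟩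
      (fun x hx hx0 => hd.le hx.1 hx0) fun x hx => (by omega : _ ≤ 4 * k + 6).trans (hle x hx)
  have hSE := isSinglyEvenSelfDual_shadowNeighbor hC hv (hmod v hv)
  refine ⟨⟨hSE, 4 * k + 4, 4 * k + 6, hN, ?_, ?_⟩, ⟨hSE.1, ?_⟩,
    (finrank_shadowNeighbor hC hv).trans hf, hN⟩
  · refine hasMinWeight_shadow_shadowNeighbor hC hv (hmod v hv) (by omega)
      ⟨u, Or.inr ⟨hu, hvu⟩, hus⟩ (fun x hx hx2 => ?_) hle
    have := hd.le hx (by omega)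
    omega
  · rw [if_neg (by omega)]
    omega
  · rw [if_neg (by omega), show (24 * k + 20) / 24 = k by omega]
    exact hN

theorem shadowNeighborsSatisfy_length_twelve_mod {k : ℕ} {C : BinaryCode (24 * k + 12)}
    (hC : IsSExtremal C) (hp : HasParameters C (12 * k + 6) (4 * k + 2)) :
    ShadowNeighborsSatisfy C fun N =>
      IsSExtremal N ∧ IsExtremal N ∧ HasParameters N (12 * k + 6) (4 * k + 4) := by
  obtain ⟨hf, hd⟩ := hp
  obtain ⟨s, hs, hsd⟩ := hC.hasMinWeight_shadow hd (by omega)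
  obtain rfl : s = 4 * k + 6 := by omega
  replace hC := hC.1
  have hn : 24 * k + 12 = 2 * Module.finrank (ZMod 2) C := by omega
  have hm : Module.finrank (ZMod 2) C % 4 = 2 := by omega
  refine shadowNeighborsSatisfy_of hC hn hm fun v hv => ?_
  have hmod := fun u hu => shadow_hammingNorm_mod_four hC hn hm (u := u) hu
  have hle : ∀ x ∈ shadow C, 4 * k + 6 ≤ hammingNorm x := fun x hx => hs.le hx (by
    have := hmod x hx
    omega)
  have hSE := isSinglyEvenSelfDual_shadowNeighbor hC hv (hmod v hv)
  have hfN := (finrank_shadowNeighbor hC hv).trans hf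
  have hS : HasMinWeight (shadow (shadowNeighbor C hC.1 v)) (4 * k + 2) := by
    obtain ⟨_, c, hc, hcd⟩ := hd.1
    exact hasMinWeight_shadow_shadowNeighbor hC hv (hmod v hv) (by omega)
      ⟨c, Or.inl ⟨hc, by omega⟩, hcd⟩ (fun x hx hx2 => hd.le hx (by omega))
      fun x hx => (by omega : _ ≤ 4 * k + 6).trans (hle x hx)
  have h0 : ∀ x ∈ doublyEvenPart C, hammingNorm x ≠ 0 → 4 * k + 4 ≤ hammingNorm x := by
    intro x hx hx0
    have h1 := hd.le hx.1 hx0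
    have h2 := hx.2
    omega
  have hN : HasMinWeight (shadowNeighbor C hC.1 v : Set (BinaryVector (24 * k + 12)))
      (4 * k + 4) := by
    refine hasMinWeight_shadowNeighbor hC hv (by omega) ?_ h0
      fun x hx => (by omega : _ ≤ 4 * k + 6).trans (hle x hx)
    have hS0 : ∀ u ∈ shadow (shadowNeighbor C hC.1 v), 4 * k + 2 ≤ hammingNorm u := by
      refine fun u hu => hS.le hu (hammingNorm_ne_zero_iff.2 ?_)
      rintro rfl
      exact hu.2 (Submodule.zero_mem _)
    -- A nonzero word of weight below `4k+6` cannot come from the old shadow, so it lies in `C₀`,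
    -- where divisibility by 4 forces its weight to be `4k+4`.
    obtain ⟨x, hx, hx0, hxlt⟩ := exists_hammingNorm_lt hSE hfN hS0
    refine ⟨x, hx, ?_⟩
    rw [← hammingNorm_ne_zero_iff] at hx0
    rcases mem_shadowNeighbor.1 hx with hx | hx
    · have h1 := h0 x hx hx0
      have h2 := hx.2
      omega
    · have := hle x ((mem_shadow_iff hC hv).2 hx.1)
      omega
  refine ⟨⟨hSE, 4 * k + 4, 4 * k + 2, hN, hS, ?_⟩, ⟨hSE.1, ?_⟩, hfN, hN⟩
  · rw [if_neg (by omega)]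
    omega
  · rw [if_neg (by omega), show (24 * k + 12) / 24 = k by omega]
    exact hN

end BinaryCode

theorem proposition1 (k : ℕ) :
    (∀ C : BinaryCode (24 * k + 4),
      BinaryCode.IsSExtremal C → BinaryCode.HasParameters C (12 * k + 2) (4 * k + 2) →
        BinaryCode.ShadowNeighborsSatisfy C fun N =>
          BinaryCode.IsSExtremal N ∧ BinaryCode.HasParameters N (12 * k + 2) (4 * k + 2)) ∧
    (∀ C : BinaryCode (24 * k + 20),
      BinaryCode.IsSExtremal C → BinaryCode.IsExtremal C →
      BinaryCode.HasParameters C (12 * k + 10) (4 * k + 4) →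
        BinaryCode.ShadowNeighborsSatisfy C fun N =>
          BinaryCode.IsSExtremal N ∧ BinaryCode.IsExtremal N ∧
            BinaryCode.HasParameters N (12 * k + 10) (4 * k + 4)) ∧
    (∀ C : BinaryCode (24 * k + 12),
      BinaryCode.IsSExtremal C → BinaryCode.HasParameters C (12 * k + 6) (4 * k + 2) →
        BinaryCode.ShadowNeighborsSatisfy C fun N =>
          BinaryCode.IsSExtremal N ∧ BinaryCode.IsExtremal N ∧
            BinaryCode.HasParameters N (12 * k + 6) (4 * k + 4)) :=
  ⟨fun _ hC hp => BinaryCode.shadowNeighborsSatisfy_length_four_mod hC hp,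
    fun _ hC _ hp => BinaryCode.shadowNeighborsSatisfy_length_twenty_mod hC hp,
    fun _ hC hp => BinaryCode.shadowNeighborsSatisfy_length_twelve_mod hC hp⟩
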